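/- **Definitions.** A maximization problem consists of a set $\mathcal S$ of feasible solutions and a family $\mathcal F$ of objective functions $f\colon\mathcal S\to\mathbb R$. Given numbers $f^*\ge\max f$ $(f\in\mathcal F)$, called approximation guarantees, an LP formulation consists of a system of linear inequalities $Ax\le b$ in variables $x\in\mathbb R^d$ for some $d$, a point $x^s\in\mathbb R^d$ with $Ax^s\le b$ for every $s\in\mathcal S$, and an affine map $w^f\colon\mathbb R^d\to\mathbb R$ for every $f\in\mathcal F$ with $w^f(x^s)=f(s)$ for all $s\in\mathcal S$, such that $w^f(x)\le f^*$ for every $x$ with $Ax\le b$. Its size is the number of inequalities in $Ax\le b$. The formulation complexity $\mathrm{fc}$ of the problem with these guarantees is the minimum size of an LP formulation; for a maximization problem $\mathcal P$ and $0<\rho\le 1$, $\mathrm{fc}(\mathcal P,\rho)$ denotes the formulation complexity for the guarantees $f^*=\max f/\rho$. The matching problem $\mathrm{Matching}_n$ has as feasible solutions all matchings $M$ of the complete graph $K_n$ on $[n]=\{1,\dots,n\}$, and its objective functions are $f_G(M)=|M\cap E(G)|$, for all graphs $G$ with $V(G)\subseteq[n]$. For even $n$ and $0<\varepsilon<1$,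 the restricted approximate matching problem $\mathrm{Matching}^*_{n,\varepsilon}$ has as feasible solutions the perfect matchings of $K_n$, as objective functions the $f_{K_U}$ for the complete graphs $K_U$ on sets $U\subseteq[n]$ of odd size, and the guarantees $f_{K_U}^*=\frac{|U|-1+\varepsilon}{2}$. A family $(\mathcal P_n)_{n\in\mathbb N}$ of maximization problems admits a fully polynomial-size linear programming relaxation scheme (FPSRS) if there is a polynomial $p$ in two variables such that $\mathrm{fc}(\mathcal P_n,1-\varepsilon)\le p(n,1/\varepsilon)$ for all $0<\varepsilon<1$ and all $n$. **Theorem.** Let $0<\varepsilon<1$ be fixed. For even $n$, $$\mathrm{fc}(\mathrm{Matching}^*_{n,\varepsilon})=2^{\Theta(n)}\qquad\text{and}\qquad \mathrm{fc}\bigl(\mathrm{Matching}_n,\,1-\tfrac{\varepsilon}{n}\bigr)=2^{\Theta(n)},$$ that is, for each of these two quantities there are constants $c,C>0$ and $N$, depending only on $\varepsilon$, such that the quantity lies between $2^{cn}$ and $2^{Cn}$ for all even $n\ge N$. Consequently, the matching problem $(\mathrm{Matching}_n)_{n\in\mathbb N}$ does not admit an FPSRS. -/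

import Mathlib

/-- A maximization problem: a type of feasible solutions and a family of real-valued objective
functions on the feasible solutions. -/
structure MaximizationProblem where
  /-- feasible solutions -/
  Sol : Type
  /-- (indices of) objective functions -/
  Obj : Type
  /-- `value f s` is the value `f(s)` of the objective function `f` at the solution `s` -/
  value : Obj → Sol → ℝ

/-- The maximum `max f` of an objective function over all feasible solutions. (It is written as a
supremum; it is attained whenever there are finitely many, and at least one, feasible solutions.) -/
noncomputable def MaximizationProblem.maxValue (P : MaximizationProblem) (f : P.Obj) : ℝ :=
  ⨆ s : P.Sol, P.value f s

/-- An approximation problem: a maximization problem with a number `f*` for each objective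
function `f`, such that `max f ≤ f*`. -/
structure ApproximationProblem extends MaximizationProblem where
  /-- the approximation guarantees `f*` -/
  guarantee : Obj → ℝ
  le_guarantee : ∀ f s, value f s ≤ guarantee f

/-- An LP formulation of the maximization problem `P` with guarantees `g f` (`= f*`):
a linear program `A x ≤ b`, feasible realizations `x^s` of the solutions, and affine realizations
`w^f` of the objective functions with `w^f(x^s) = f(s)`, such that the maximum of `w^f(x)` subject
to `A x ≤ b` is at most `f*`. -/
structure LPFormulation (P : MaximizationProblem) (g : P.Obj → ℝ) where
  /-- number of variables -/
  dim : ℕ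
  /-- number of inequalities -/
  size : ℕ
  A : Matrix (Fin size) (Fin dim) ℝ
  b : Fin size → ℝ
  x : P.Sol → (Fin dim → ℝ)
  w : P.Obj → ((Fin dim → ℝ) →ᵃ[ℝ] ℝ)
  feasible : ∀ s, A.mulVec (x s) ≤ b
  w_eq : ∀ f s, w f (x s) = P.value f s
  w_le : ∀ f (y : Fin dim → ℝ), A.mulVec y ≤ b → w f y ≤ g f

/-- The least size of an LP formulation of `P` with guarantees `g` (`⊤` if there is none). -/
noncomputable def minLPSize (P : MaximizationProblem) (g : P.Obj → ℝ) : ℕ∞ :=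
  ⨅ L : LPFormulation P g, (L.size : ℕ∞)

/-- The formulation complexity `fc(P*)` of an approximation problem. -/
noncomputable def ApproximationProblem.fc (P : ApproximationProblem) : ℕ∞ :=
  minLPSize P.toMaximizationProblem P.guarantee

/-- The guarantees `f* = max f / ρ` given by an approximation factor `ρ`. -/
noncomputable def MaximizationProblem.factorGuarantee (P : MaximizationProblem) (ρ : ℝ) :
    P.Obj → ℝ :=
  fun f => P.maxValue f / ρ

/-- The formulation complexity `fc(P, ρ)` of `P` with approximation factor `ρ`. -/
noncomputable def MaximizationProblem.fcFactor (P : MaximizationProblem) (ρ : ℝ) : ℕ∞ :=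
  minLPSize P (P.factorGuarantee ρ)

/-- The family `P n` admits a fully polynomial-size linear programming relaxation scheme:
the size of suitable LP formulations with approximation factor `1 - ε` is bounded by a polynomial
in `n` and `1 / ε`. (Approximation factors are positive, so `ε < 1`.) -/
def AdmitsFPSRS (P : ℕ → MaximizationProblem) : Prop :=
  ∃ p : MvPolynomial (Fin 2) ℝ, ∀ ε : ℝ, 0 < ε → ε < 1 → ∀ n : ℕ,
    ∃ L : LPFormulation (P n) ((P n).factorGuarantee (1 - ε)),
      (L.size : ℝ) ≤ MvPolynomial.eval ![(n : ℝ), 1 / ε] p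

/-- The complete graph `K_n`. -/
abbrev completeG (n : ℕ) : SimpleGraph (Fin n) := ⊤

/-- The matching problem: the solutions are all matchings `M` of `K_n`, the objective functions are
indexed by all graphs `G` with `V(G) ⊆ [n]`, i.e. by the subgraphs of `K_n`, and
`f_G(M) = |M ∩ E(G)|`. -/
noncomputable def matchingProblem (n : ℕ) : MaximizationProblem where
  Sol := {M : (completeG n).Subgraph // M.IsMatching}
  Obj := (completeG n).Subgraph
  value G M := ((M.1.edgeSet ∩ G.edgeSet).ncard : ℝ)

/-- The complete graph `K_U` on the vertex set `U`, as a subgraph of `K_n`. -/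
def completeOn {n : ℕ} (U : Finset (Fin n)) : (completeG n).Subgraph :=
  (⊤ : (completeG n).Subgraph).induce (U : Set (Fin n))

/-- A matching has at most `(|U| - 1) / 2` edges inside a vertex set `U` of odd size. -/
theorem matching_value_completeOn_le {n : ℕ} (U : Finset (Fin n)) (hU : Odd U.card)
    (M : (completeG n).Subgraph) (hM : M.IsMatching) :
    ((M.edgeSet ∩ (completeOn U).edgeSet).ncard : ℝ) ≤ ((U.card : ℝ) - 1) / 2 := by
  classical
  let H : SimpleGraph (Fin n) := (M ⊓ completeOn U).spanningCoe
  have hE : M.edgeSet ∩ (completeOn U).edgeSet = (H.edgeFinset : Set (Sym2 (Fin n))) := by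
    simp [H, SimpleGraph.Subgraph.edgeSet_inf]
  have hdeg : ∀ v, H.degree v ≤ if v ∈ U then 1 else 0 := by
    intro v
    have hsub : ∀ u ∈ H.neighborFinset v, v ∈ U ∧ M.Adj v u := by
      intro u hu
      have h : M.Adj v u ∧ (completeOn U).Adj v u := by simpa [H] using hu
      exact ⟨by simpa using h.2.1, h.1⟩
    rw [← SimpleGraph.card_neighborFinset_eq_degree]
    split_ifs with hv
    · refine Finset.card_le_one.2 fun a ha b hb => ?_
      exact hM.eq_of_adj_left (hsub a ha).2 (hsub b hb).2
    · rw [Nat.le_zero, Finset.card_eq_zero, Finset.eq_empty_iff_forall_notMem]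
      exact fun u hu => hv (hsub u hu).1
  have h2 : 2 * H.edgeFinset.card ≤ U.card := by
    rw [← SimpleGraph.sum_degrees_eq_twice_card_edges]
    calc _ ≤ ∑ v, (if v ∈ U then 1 else 0) := Finset.sum_le_sum fun v _ => hdeg v
      _ = U.card := by simp
  have h3 : 2 * H.edgeFinset.card + 1 ≤ U.card := by
    obtain ⟨k, hk⟩ := hU
    omega
  rw [hE, Set.ncard_coe_finset]
  have h4 : (2 * (H.edgeFinset.card : ℝ)) + 1 ≤ U.card := by exact_mod_cast h3
  linarith

/-- The restricted approximate matching problem `Matching*_ε` on `[n]`: the subproblem of the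
matching problem with the perfect matchings as solutions and the objective functions `f_{K_U}` for
`U ⊆ [n]` of odd size, with guarantees `(|U| - 1 + ε) / 2`. -/
noncomputable def restrictedMatchingProblem (n : ℕ) (ε : ℝ) (hε : 0 < ε) :
    ApproximationProblem where
  Sol := {M : (completeG n).Subgraph // M.IsPerfectMatching}
  Obj := {U : Finset (Fin n) // Odd U.card}
  value U M := (matchingProblem n).value (completeOn U.1) ⟨M.1, M.2.1⟩
  guarantee U := ((U.1.card : ℝ) - 1 + ε) / 2
  le_guarantee U M :=
    (matching_value_completeOn_le U.1 U.2 M.1 M.2.1).trans (by linarith)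

/-- `a n = 2^{Θ(n)}` for even `n`: there are constants `c, C > 0` such that the number `a n` is
finite and `2^{c n} ≤ a n ≤ 2^{C n}` for all sufficiently large even `n`. -/
def IsTwoPowThetaEven (a : ℕ → ℕ∞) : Prop :=
  ∃ c C : ℝ, 0 < c ∧ 0 < C ∧ ∃ N : ℕ, ∀ n : ℕ, N ≤ n → Even n →
    ∃ k : ℕ, a n = (k : ℕ∞) ∧ (2 : ℝ) ^ (c * (n : ℝ)) ≤ (k : ℝ) ∧
      (k : ℝ) ≤ (2 : ℝ) ^ (C * (n : ℝ))

open scoped BigOperators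

/-- Averaging over all points of a product is the same as resampling one coordinate first. -/
lemma expect_eq_expect_update {ι Ω : Type*} [Fintype ι] [DecidableEq ι] [Fintype Ω] [Nonempty Ω]
    (G : (ι → Ω) → ℝ) (i : ι) :
    𝔼 ω, G ω = 𝔼 a, 𝔼 ω, G (Function.update ω i a) := by
  have h1 : 𝔼 ω, G ω = 𝔼 p : Ω × (ι → Ω), G p.2 := by
    rw [← Finset.univ_product_univ, Finset.expect_product' _ _ fun _ ω => G ω]
    simp
  have h2 : 𝔼 a, 𝔼 ω, G (Function.update ω i a)
      = 𝔼 p : Ω × (ι → Ω), G (Function.update p.2 i p.1) := by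
    rw [← Finset.univ_product_univ,
      Finset.expect_product' _ _ fun a ω => G (Function.update ω i a)]
  have hinv : Function.Involutive
      fun p : Ω × (ι → Ω) => ((p.2 i, Function.update p.2 i p.1) : Ω × (ι → Ω)) := by
    rintro ⟨a, ω⟩
    simp
  rw [h1, h2]
  exact Fintype.expect_bijective _ hinv.bijective _ _ fun p => by simp

lemma expect_prod_apply {ι Ω : Type*} [Fintype ι] [DecidableEq ι] [Fintype Ω]
    (φ : ι → Ω → ℝ) : 𝔼 ω : ι → Ω, ∏ i, φ i (ω i) = ∏ i, 𝔼 a, φ i a := by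
  simp only [Fintype.expect_eq_sum_div_card, Finset.prod_div_distrib, Finset.prod_univ_sum,
    Fintype.piFinset_univ, Fintype.card_fun, Finset.prod_const, Finset.card_univ, Nat.cast_pow]

lemma sub_two_mul_sq_le_log {x : ℝ} (hx : |x| ≤ 1 / 2) : x - 2 * x ^ 2 ≤ Real.log (1 + x) := by
  have hx1 := (abs_le.1 hx).1
  have hpos : 0 < 1 + x := by linarith
  refine le_trans ?_ (Real.one_sub_inv_le_log_of_pos hpos)
  rw [← sub_nonneg]
  have : 1 - (1 + x)⁻¹ - (x - 2 * x ^ 2) = x ^ 2 * (1 + 2 * x) / (1 + x) := by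
    field_simp
    ring
  rw [this]
  have : 0 ≤ 1 + 2 * x := by linarith
  positivity

/-- A function on `Ω` with mean one that detects a biased marginal. -/
lemma exists_tilt {Ω : Type*} [Fintype Ω] [Nonempty Ω] (p : Ω → ℝ) (hp : ∀ a, 0 ≤ p a)
    {γ : ℝ} (hγ : 0 < γ) (hγ1 : γ ≤ 1) (a₀ : Ω) (h : γ * 𝔼 a, p a < |p a₀ - 𝔼 a, p a|) :
    ∃ φ : Ω → ℝ, (∀ a, 0 < φ a) ∧ 𝔼 a, φ a = 1 ∧
      γ ^ 2 / (8 * (Fintype.card Ω : ℝ) ^ 2) * 𝔼 a, p a ≤ 𝔼 a, p a * Real.log (φ a) := by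
  classical
  set K : ℝ := (Fintype.card Ω : ℝ) with hK
  have hK1 : 1 ≤ K := by
    rw [hK]; exact_mod_cast Fintype.card_pos
  set q := 𝔼 a, p a with hq
  have hq0 : 0 ≤ q := Finset.expect_nonneg fun a _ => hp a
  obtain ⟨s, hs, hsabs⟩ : ∃ s : ℝ, s ^ 2 = 1 ∧ s * (p a₀ - q) = |p a₀ - q| := by
    rcases abs_cases (p a₀ - q) with h | h
    · exact ⟨1, by norm_num, by rw [h.1]; ring⟩
    · exact ⟨-1, by norm_num, by rw [h.1]; ring⟩
  set θ := s * (γ / (4 * K)) with hθ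
  set y : Ω → ℝ := fun a => (if a = a₀ then 1 else 0) - 1 / K with hy
  have hy1 : ∀ a, |y a| ≤ 1 := by
    intro a
    have h1 : 0 < 1 / K := by positivity
    have h2 : 1 / K ≤ 1 := by rw [div_le_one (by linarith)]; exact hK1
    simp only [hy]
    rw [abs_le]
    split_ifs <;> constructor <;> linarith
  have hsabs1 : |s| = 1 := by
    rw [← sq_eq_sq₀ (abs_nonneg _) zero_le_one, sq_abs, hs, one_pow]
  have hθabs : |θ| = γ / (4 * K) := by
    rw [hθ, abs_mul, hsabs1, one_mul, abs_of_pos (by positivity)]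
  have hθ4 : |θ| ≤ 1 / 4 := by
    rw [hθabs, div_le_div_iff₀ (by positivity) (by norm_num)]
    nlinarith
  have hx : ∀ a, |θ * y a| ≤ 1 / 4 := by
    intro a
    rw [abs_mul]
    calc _ ≤ 1 / 4 * 1 := mul_le_mul hθ4 (hy1 a) (abs_nonneg _) (by norm_num)
      _ = 1 / 4 := by ring
  have hmean : 𝔼 a, (if a = a₀ then (1 : ℝ) else 0) = 1 / K := by
    rw [Fintype.expect_eq_sum_div_card]; simp [hK]
  have hpy : 𝔼 a, p a * y a = (p a₀ - q) / K := by
    have h1 : ∀ a, p a * y a = (if a = a₀ then p a₀ else 0) - p a * (1 / K) := by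
      intro a
      simp only [hy]
      split_ifs with h
      · rw [h]; ring
      · ring
    simp only [h1, Finset.expect_sub_distrib, ← Finset.expect_mul]
    rw [Fintype.expect_eq_sum_div_card (fun a => if a = a₀ then p a₀ else 0)]
    simp [← hK, ← hq]
    ring
  refine ⟨fun a => 1 + θ * y a, fun a => ?_, ?_, ?_⟩
  · have := (abs_le.1 (hx a)).1
    linarith
  · have h1 : 𝔼 a, y a = 0 := by
      simp only [hy, Finset.expect_sub_distrib, hmean, Fintype.expect_const]
      ring
    rw [Finset.expect_add_distrib, ← Finset.mul_expect, h1, Fintype.expect_const]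
    ring
  · calc γ ^ 2 / (8 * K ^ 2) * q
        = γ / (4 * K) * (γ * q / K) - 2 * (γ / (4 * K)) ^ 2 * q := by field_simp; ring
      _ ≤ γ / (4 * K) * (|p a₀ - q| / K) - 2 * (γ / (4 * K)) ^ 2 * q := by gcongr
      _ = θ * ((p a₀ - q) / K) - 2 * θ ^ 2 * q := by
          rw [← hsabs, hθ, mul_pow, hs]; ring
      _ = 𝔼 a, (θ * (p a * y a) - 2 * θ ^ 2 * p a) := by
          rw [Finset.expect_sub_distrib, ← Finset.mul_expect, ← Finset.mul_expect, hpy]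
      _ ≤ 𝔼 a, p a * Real.log (1 + θ * y a) := by
          refine Finset.expect_le_expect fun a _ => ?_
          have h1 := sub_two_mul_sq_le_log ((hx a).trans (by norm_num))
          have h2 : y a ^ 2 ≤ 1 := by rw [← sq_abs]; exact pow_le_one₀ (abs_nonneg _) (hy1 a)
          calc θ * (p a * y a) - 2 * θ ^ 2 * p a
              ≤ θ * (p a * y a) - 2 * θ ^ 2 * p a * y a ^ 2 := by
                have : 0 ≤ 2 * θ ^ 2 * p a := by have := hp a; positivity
                nlinarith
            _ = p a * (θ * y a - 2 * (θ * y a) ^ 2) := by ring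
            _ ≤ _ := mul_le_mul_of_nonneg_left h1 (hp a)

/-- A `[0,1]`-valued function on a product space whose mean is not small has few coordinates along
which the marginals are biased. -/
lemma card_biased_le {ι Ω : Type*} [Fintype ι] [DecidableEq ι] [Fintype Ω] [Nonempty Ω]
    (F : (ι → Ω) → ℝ) (hF0 : ∀ ω, 0 ≤ F ω) (hF1 : ∀ ω, F ω ≤ 1) {γ : ℝ} (hγ : 0 < γ)
    (hγ1 : γ ≤ 1) (hpos : 0 < 𝔼 ω, F ω) (B : Finset ι)
    (hB : ∀ i ∈ B, ∃ a, γ * 𝔼 ω, F ω < |𝔼 ω, F (Function.update ω i a) - 𝔼 ω, F ω|) :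
    γ ^ 2 / (8 * (Fintype.card Ω : ℝ) ^ 2) * B.card ≤ -Real.log (𝔼 ω, F ω) := by
  classical
  set q := 𝔼 ω, F ω with hq
  set c := γ ^ 2 / (8 * (Fintype.card Ω : ℝ) ^ 2) with hc
  have hφ : ∀ i, ∃ φ : Ω → ℝ, (∀ a, 0 < φ a) ∧ 𝔼 a, φ a = 1 ∧
      (if i ∈ B then c * q else 0) ≤ 𝔼 ω, F ω * Real.log (φ (ω i)) := by
    intro i
    by_cases hi : i ∈ B
    · obtain ⟨a₀, ha₀⟩ := hB i hi
      have hmean : 𝔼 a, 𝔼 ω, F (Function.update ω i a) = q := (expect_eq_expect_update F i).symm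
      obtain ⟨φ, h1, h2, h3⟩ := exists_tilt (fun a => 𝔼 ω, F (Function.update ω i a))
        (fun a => Finset.expect_nonneg fun _ _ => hF0 _) hγ hγ1 a₀ (by simpa only [hmean] using ha₀)
      refine ⟨φ, h1, h2, ?_⟩
      rw [if_pos hi, expect_eq_expect_update _ i]
      simp only [Function.update_self, ← Finset.expect_mul]
      simpa only [hmean] using h3
    · exact ⟨fun _ => 1, by simp, Fintype.expect_const _, by simp [hi]⟩
  choose φ hφpos hφmean hφ using hφ
  set Y : (ι → Ω) → ℝ := fun ω => ∏ i, φ i (ω i) with hY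
  have hYpos : ∀ ω, 0 < Y ω := fun ω => Finset.prod_pos fun i _ => hφpos i _
  have hYmean : 𝔼 ω, Y ω = 1 := by
    rw [hY, expect_prod_apply]; simp [hφmean]
  have h1 : B.card * (c * q) ≤ 𝔼 ω, F ω * Real.log (Y ω) := by
    calc (B.card : ℝ) * (c * q) = ∑ i, if i ∈ B then c * q else 0 := by simp
      _ ≤ ∑ i, 𝔼 ω, F ω * Real.log (φ i (ω i)) := Finset.sum_le_sum fun i _ => hφ i
      _ = 𝔼 ω, F ω * Real.log (Y ω) := by
        rw [← Finset.expect_sum_comm]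
        refine Finset.expect_congr rfl fun ω _ => ?_
        rw [hY, Real.log_prod fun i _ => (hφpos i _).ne', Finset.mul_sum]
  have h2 : 𝔼 ω, F ω * Real.log (Y ω) ≤ -(Real.log q * q) := by
    calc 𝔼 ω, F ω * Real.log (Y ω)
        ≤ 𝔼 ω, (Y ω * q - F ω * (1 + Real.log q)) := by
          refine Finset.expect_le_expect fun ω _ => ?_
          have h := Real.log_le_sub_one_of_pos (mul_pos (hYpos ω) hpos)
          rw [Real.log_mul (hYpos ω).ne' hpos.ne'] at h
          have h3 := mul_le_mul_of_nonneg_left h (hF0 ω)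
          have h4 : F ω * (Y ω * q) ≤ 1 * (Y ω * q) :=
            mul_le_mul_of_nonneg_right (hF1 ω) (mul_pos (hYpos ω) hpos).le
          linarith
      _ = -(Real.log q * q) := by
          rw [Finset.expect_sub_distrib, ← Finset.expect_mul, ← Finset.expect_mul, hYmean, ← hq]
          ring
  have h3 : c * B.card * q ≤ -Real.log q * q := by linarith
  exact le_of_mul_le_mul_right h3 hpos

section DirectSum

variable {ι Ω : Type*} [Fintype ι] [DecidableEq ι] [Fintype Ω]

/-- The configuration that is `ω` on the active coordinates and `o` on the others. -/
def fillWith (o : Ω) (τ : ι → Bool) (ω : ι → Ω) : ι → Ω := fun j => if τ j then ω j else o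

/-- The average of `F` over the active coordinates, where coordinate `i` is fixed to `a`. -/
noncomputable def marginal (o : Ω) (F : (ι → Ω) → ℝ) (τ : ι → Bool) (i : ι) (a : Ω) : ℝ :=
  𝔼 ω, F (Function.update (fillWith o τ ω) i a)

/-- Some value of the marginal deviates from its mean by more than the factor `γ`. -/
def Biased (γ : ℝ) (p : Ω → ℝ) : Prop := ∃ a, γ * 𝔼 a, p a < |p a - 𝔼 a, p a|

lemma marginal_update (o : Ω) (F : (ι → Ω) → ℝ) (τ : ι → Bool) (i : ι) (c : Bool) :
    marginal o F (Function.update τ i c) i = marginal o F τ i := by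
  funext a
  refine Finset.expect_congr rfl fun ω _ => congrArg F ?_
  funext j
  by_cases h : j = i
  · subst h; simp
  · simp [fillWith, h]

lemma marginal_nonneg (o : Ω) {F : (ι → Ω) → ℝ} (hF : ∀ ω, 0 ≤ F ω) (τ : ι → Bool) (i : ι)
    (a : Ω) : 0 ≤ marginal o F τ i a :=
  Finset.expect_nonneg fun _ _ => hF _

omit [Fintype ι] [Fintype Ω] in
lemma update_fillWith_of_active (o : Ω) {τ : ι → Bool} {i : ι} (h : τ i = true) (ω : ι → Ω)
    (a : Ω) : Function.update (fillWith o τ ω) i a = fillWith o τ (Function.update ω i a) := by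
  funext j
  by_cases hj : j = i
  · subst hj; simp [fillWith, h]
  · simp [fillWith, hj]

lemma expect_fillWith_of_active [Nonempty Ω] (o : Ω) (F : (ι → Ω) → ℝ) {τ : ι → Bool} {i : ι}
    (h : τ i = true) : 𝔼 ω, F (fillWith o τ ω) = 𝔼 a, marginal o F τ i a := by
  rw [expect_eq_expect_update _ i]
  simp only [marginal, update_fillWith_of_active o h]

lemma expect_fillWith_of_inactive (o : Ω) (F : (ι → Ω) → ℝ) {τ : ι → Bool} {i : ι}
    (h : τ i = false) : 𝔼 ω, F (fillWith o τ ω) = marginal o F τ i o := by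
  refine Finset.expect_congr rfl fun ω _ => congrArg F ?_
  funext j
  by_cases hj : j = i
  · subst hj; simp [fillWith, h]
  · simp [hj]

open Classical in
lemma expect_biased_le [Nonempty ι] [Nonempty Ω] (o : Ω) (F : (ι → Ω) → ℝ) (hF0 : ∀ ω, 0 ≤ F ω)
    (hF1 : ∀ ω, F ω ≤ 1) {γ η δ : ℝ} (hγ : 0 < γ) (hγ1 : γ ≤ 1) (hη : 0 ≤ η)
    (hδ : δ ≤ η * (γ ^ 2 / (8 * (Fintype.card Ω : ℝ) ^ 2))) (τ : ι → Bool) :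
    𝔼 i, (if τ i = true ∧ Biased γ (marginal o F τ i) then 𝔼 ω, F (fillWith o τ ω) else 0) ≤
      η * 𝔼 ω, F (fillWith o τ ω) + Real.exp (-δ * Fintype.card ι) := by
  set q := 𝔼 ω, F (fillWith o τ ω) with hq
  set N : ℝ := (Fintype.card ι : ℝ) with hN
  have hN0 : 0 < N := by rw [hN]; exact_mod_cast Fintype.card_pos
  have hK0 : (0 : ℝ) < Fintype.card Ω := by exact_mod_cast Fintype.card_pos
  set c := γ ^ 2 / (8 * (Fintype.card Ω : ℝ) ^ 2) with hc
  have hc0 : 0 < c := by positivity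
  have hq0 : 0 ≤ q := Finset.expect_nonneg fun _ _ => hF0 _
  set B : Finset ι := Finset.univ.filter
    fun i => τ i = true ∧ Biased γ (marginal o F τ i) with hBdef
  have hsum : 𝔼 i, (if τ i = true ∧ Biased γ (marginal o F τ i) then q else 0)
      = B.card / N * q := by
    rw [Fintype.expect_eq_sum_div_card, ← Finset.sum_filter, Finset.sum_const, nsmul_eq_mul]
    ring
  have hBN : (B.card : ℝ) / N ≤ 1 := by
    rw [div_le_one hN0, hN]
    exact_mod_cast Finset.card_le_univ B
  rw [hsum]
  by_cases hlow : q ≤ Real.exp (-δ * N)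
  · calc B.card / N * q ≤ 1 * q := mul_le_mul_of_nonneg_right hBN hq0
      _ ≤ η * q + Real.exp (-δ * N) := by nlinarith
  · push Not at hlow
    have hqpos : 0 < q := (Real.exp_pos _).trans hlow
    have hlog : -Real.log q ≤ δ * N := by
      have := (Real.lt_log_iff_exp_lt hqpos).2 hlow
      linarith
    have hcard := card_biased_le (fun ω => F (fillWith o τ ω)) (fun _ => hF0 _) (fun _ => hF1 _)
      hγ hγ1 hqpos B (fun i hi => by
        obtain ⟨hτ, a, ha⟩ := (Finset.mem_filter.1 hi).2
        refine ⟨a, ?_⟩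
        rw [← expect_fillWith_of_active o F hτ] at ha
        simpa only [marginal, update_fillWith_of_active o hτ] using ha)
    have h1 : (B.card : ℝ) / N ≤ η := by
      rw [div_le_iff₀ hN0]
      have h2 : c * B.card ≤ c * (η * N) :=
        calc c * B.card ≤ δ * N := hcard.trans hlog
          _ ≤ η * c * N := mul_le_mul_of_nonneg_right hδ hN0.le
          _ = c * (η * N) := by ring
      exact le_of_mul_le_mul_left h2 hc0
    calc B.card / N * q ≤ η * q := mul_le_mul_of_nonneg_right h1 hq0
      _ ≤ _ := le_add_of_nonneg_right (Real.exp_pos _).le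

lemma expect_ite_active (X : (ι → Bool) → ℝ) (i : ι) (s : Bool)
    (hX : ∀ τ c, X (Function.update τ i c) = X τ) :
    𝔼 τ : ι → Bool, (if τ i = s then X τ else 0) = 1 / 2 * 𝔼 τ, X τ := by
  rw [expect_eq_expect_update _ i]
  simp only [Function.update_self, hX]
  rw [Fintype.expect_eq_sum_div_card]
  cases s <;> simp <;> ring

lemma le_card_mul_expect (p : Ω → ℝ) (hp : ∀ a, 0 ≤ p a) (a : Ω) :
    p a ≤ Fintype.card Ω * 𝔼 a, p a := by
  rw [Fintype.card_mul_expect]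
  exact Finset.single_le_sum (fun a _ => hp a) (Finset.mem_univ a)

lemma abs_sub_le_of_not_biased {γ : ℝ} {p : Ω → ℝ} (h : ¬ Biased γ p) (a : Ω) :
    |p a - 𝔼 a, p a| ≤ γ * 𝔼 a, p a := by
  by_contra hlt
  exact h ⟨a, not_le.1 hlt⟩

lemma expect_le_two_mul_of_not_biased {γ : ℝ} (hγ : γ ≤ 1 / 2) {p : Ω → ℝ} (hp : ∀ a, 0 ≤ p a)
    (h : ¬ Biased γ p) (a : Ω) : 𝔼 a, p a ≤ 2 * p a := by
  have h1 := (abs_le.1 (abs_sub_le_of_not_biased h a)).1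
  have h2 : 0 ≤ 𝔼 a, p a := Finset.expect_nonneg fun a _ => hp a
  nlinarith

end DirectSum

/-- The weight of the pair of functions `f`, `g` on the distribution where at coordinate `i` the
first player has the value `oU` and the second a uniform one, and at each other coordinate one of
the players has a fixed value and the other a uniform one. -/
noncomputable def disjointWeight {ι ΩU ΩM : Type*} [Fintype ι] [DecidableEq ι] [Fintype ΩU]
    [Fintype ΩM] (oU : ΩU) (oM : ΩM) (f : (ι → ΩU) → ℝ) (g : (ι → ΩM) → ℝ) (τ : ι → Bool)
    (i : ι) : ℝ :=
  marginal oU f τ i oU * 𝔼 b, marginal oM g (fun j => !τ j) i b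

open Classical in
/-- Coordinates with a biased marginal contribute little to the weight on disjoint pairs. -/
theorem exists_expect_biased_disjointWeight_le {ΩU ΩM : Type*} [Fintype ΩU] [Nonempty ΩU]
    [Fintype ΩM] [Nonempty ΩM] (oU : ΩU) (oM : ΩM) {γ γ' : ℝ} (hγ : 0 < γ) (hγ1 : γ ≤ 1 / 2)
    (hγ' : 0 < γ') :
    ∃ δ C : ℝ, 0 < δ ∧ 0 < C ∧ ∀ (ι P : Type) [Fintype ι] [DecidableEq ι] [Nonempty ι]
      [Fintype P] [Nonempty P] (f : P → (ι → ΩU) → ℝ) (g : P → (ι → ΩM) → ℝ),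
      (∀ p ω, 0 ≤ f p ω) → (∀ p ω, f p ω ≤ 1) → (∀ p ω, 0 ≤ g p ω) → (∀ p ω, g p ω ≤ 1) →
      𝔼 p, 𝔼 τ, 𝔼 i, (if Biased γ (marginal oU (f p) τ i) ∨
          Biased γ (marginal oM (g p) (fun j => !τ j) i)
        then disjointWeight oU oM (f p) (g p) τ i else 0) ≤
      γ' * 𝔼 p, 𝔼 τ, 𝔼 i, disjointWeight oU oM (f p) (g p) τ i +
        C * Real.exp (-δ * Fintype.card ι) := by
  set KU : ℝ := (Fintype.card ΩU : ℝ) with hKU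
  set KM : ℝ := (Fintype.card ΩM : ℝ) with hKM
  have hKU0 : 0 < KU := by rw [hKU]; exact_mod_cast Fintype.card_pos
  have hKM0 : 0 < KM := by rw [hKM]; exact_mod_cast Fintype.card_pos
  set η : ℝ := min (1 / 2) (γ' / ((2 + 4 * KU) * (2 * KM + 1))) with hη
  have hη0 : 0 < η := lt_min (by norm_num) (by positivity)
  have hη1 : η ≤ 1 / 2 := min_le_left _ _
  have hη2 : (2 + 4 * KU) * (2 * KM + 1) * η ≤ γ' := by
    have := min_le_right (1 / 2) (γ' / ((2 + 4 * KU) * (2 * KM + 1)))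
    rw [← hη, le_div_iff₀ (by positivity)] at this
    linarith
  set δ : ℝ := η * min (γ ^ 2 / (8 * KU ^ 2)) (γ ^ 2 / (8 * KM ^ 2)) with hδ
  have hδ0 : 0 < δ := mul_pos hη0 (lt_min (by positivity) (by positivity))
  have hδU : δ ≤ η * (γ ^ 2 / (8 * KU ^ 2)) := mul_le_mul_of_nonneg_left (min_le_left _ _) hη0.le
  have hδM : δ ≤ η * (γ ^ 2 / (8 * KM ^ 2)) := mul_le_mul_of_nonneg_left (min_le_right _ _) hη0.le
  refine ⟨δ, (2 + 4 * KU) * 2, hδ0, by positivity, ?_⟩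
  intro ι P _ _ _ _ _ f g hf0 hf1 hg0 hg1
  set ξ := Real.exp (-δ * Fintype.card ι) with hξ
  have hξ0 : 0 < ξ := Real.exp_pos _
  -- abbreviations for the two marginals at the special coordinate
  set α : P → (ι → Bool) → ι → ΩU → ℝ := fun p τ i => marginal oU (f p) τ i with hα
  set β : P → (ι → Bool) → ι → ΩM → ℝ := fun p τ i => marginal oM (g p) (fun j => !τ j) i with hβ
  have hα0 : ∀ p τ i a, 0 ≤ α p τ i a := fun p τ i a => marginal_nonneg _ (hf0 p) _ _ _
  have hβ0 : ∀ p τ i b, 0 ≤ β p τ i b := fun p τ i b => marginal_nonneg _ (hg0 p) _ _ _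
  have hαu : ∀ p τ i c, α p (Function.update τ i c) i = α p τ i :=
    fun p τ i c => marginal_update _ _ _ _ _
  have hβu : ∀ p τ i c, β p (Function.update τ i c) i = β p τ i := by
    intro p τ i c
    have : (fun j => !(Function.update τ i c j)) = Function.update (fun j => !τ j) i (!c) := by
      funext j
      by_cases h : j = i
      · subst h; simp
      · simp [h]
    simp only [hβ, this, marginal_update]
  set Φ : P → (ι → Bool) → ι → ℝ := fun p τ i => α p τ i oU * 𝔼 b, β p τ i b with hΦ
  set Ψ : P → (ι → Bool) → ι → ℝ := fun p τ i => (𝔼 a, α p τ i a) * β p τ i oM with hΨ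
  have hαm : ∀ p τ i, 0 ≤ 𝔼 a, α p τ i a := fun p τ i => Finset.expect_nonneg fun _ _ => hα0 _ _ _ _
  have hβm : ∀ p τ i, 0 ≤ 𝔼 b, β p τ i b := fun p τ i => Finset.expect_nonneg fun _ _ => hβ0 _ _ _ _
  have hΦ0 : ∀ p τ i, 0 ≤ Φ p τ i := fun p τ i => mul_nonneg (hα0 _ _ _ _) (hβm _ _ _)
  have hΨ0 : ∀ p τ i, 0 ≤ Ψ p τ i := fun p τ i => mul_nonneg (hαm _ _ _) (hβ0 _ _ _ _)
  set F : P → (ι → Bool) → ℝ := fun p τ => 𝔼 ω, f p (fillWith oU τ ω) with hF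
  set G : P → (ι → Bool) → ℝ := fun p τ => 𝔼 ω, g p (fillWith oM (fun j => !τ j) ω) with hG
  have hF0 : ∀ p τ, 0 ≤ F p τ := fun p τ => Finset.expect_nonneg fun _ _ => hf0 _ _
  have hF1 : ∀ p τ, F p τ ≤ 1 :=
    fun p τ => Finset.expect_le Finset.univ_nonempty fun _ _ => hf1 _ _
  have hG0 : ∀ p τ, 0 ≤ G p τ := fun p τ => Finset.expect_nonneg fun _ _ => hg0 _ _
  have hG1 : ∀ p τ, G p τ ≤ 1 :=
    fun p τ => Finset.expect_le Finset.univ_nonempty fun _ _ => hg1 _ _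
  have hFGΨ : ∀ p τ i, τ i = true → F p τ * G p τ = Ψ p τ i := fun p τ i h => by
    simp only [hF, hG, hΨ, expect_fillWith_of_active oU (f p) h, hα, hβ]
    rw [expect_fillWith_of_inactive oM (g p) (τ := fun j => !τ j) (i := i) (by simp [h])]
  have hFGΦ : ∀ p τ i, τ i = false → F p τ * G p τ = Φ p τ i := fun p τ i h => by
    simp only [hF, hG, hΦ, expect_fillWith_of_inactive oU (f p) h, hα, hβ]
    rw [expect_fillWith_of_active oM (g p) (τ := fun j => !τ j) (i := i) (by simp [h])]
  -- the full average
  set E : (P → (ι → Bool) → ι → ℝ) → ℝ := fun X => 𝔼 p, 𝔼 τ, 𝔼 i, X p τ i with hE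
  have hEmono : ∀ X Y, (∀ p τ i, X p τ i ≤ Y p τ i) → E X ≤ E Y := fun X Y h =>
    Finset.expect_le_expect fun p _ => Finset.expect_le_expect fun τ _ =>
      Finset.expect_le_expect fun i _ => h p τ i
  have hEadd : ∀ X Y, E (fun p τ i => X p τ i + Y p τ i) = E X + E Y := fun X Y => by
    simp only [hE, Finset.expect_add_distrib]
  have hEmul : ∀ (c : ℝ) X, E (fun p τ i => c * X p τ i) = c * E X := fun c X => by
    simp only [hE, Finset.mul_expect]
  have hEactive : ∀ (s : Bool) (X : P → (ι → Bool) → ι → ℝ),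
      (∀ p τ i c, X p (Function.update τ i c) i = X p τ i) →
      E (fun p τ i => if τ i = s then X p τ i else 0) = 1 / 2 * E X := fun s X h => by
    simp only [hE, Finset.mul_expect]
    refine Finset.expect_congr rfl fun p _ => ?_
    rw [Finset.expect_comm]
    conv_rhs => rw [Finset.expect_comm]
    refine Finset.expect_congr rfl fun i _ => ?_
    rw [expect_ite_active (fun τ => X p τ i) i s fun τ c => h p τ i c, Finset.mul_expect]
  have hΨu : ∀ p τ i c, Ψ p (Function.update τ i c) i = Ψ p τ i := fun p τ i c => by
    simp only [hΨ, hαu, hβu]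
  have hΦu : ∀ p τ i c, Φ p (Function.update τ i c) i = Φ p τ i := fun p τ i c => by
    simp only [hΦ, hαu, hβu]
  set M : ℝ := 𝔼 p, 𝔼 τ, F p τ * G p τ with hM
  have hMsplit : M = 1 / 2 * E Ψ + 1 / 2 * E Φ := by
    rw [← hEactive true Ψ hΨu, ← hEactive false Φ hΦu, ← hEadd, hM]
    refine Finset.expect_congr rfl fun p _ => Finset.expect_congr rfl fun τ _ => ?_
    rw [← Fintype.expect_const (ι := ι) (F p τ * G p τ)]
    refine Finset.expect_congr rfl fun i _ => ?_
    cases h : τ i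
    · simp [h, hFGΦ p τ i h]
    · simp [h, hFGΨ p τ i h]
  have hbU : 1 / 2 * E (fun p τ i => if Biased γ (α p τ i) then Ψ p τ i else 0) ≤ η * M + ξ := by
    rw [← hEactive true _ fun p τ i c => by simp only [hαu, hΨu]]
    have h1 : ∀ p τ, 𝔼 i, (if τ i = true then (if Biased γ (α p τ i) then Ψ p τ i else 0) else 0)
        ≤ η * (F p τ * G p τ) + ξ := by
      intro p τ
      have h2 := expect_biased_le oU (f p) (hf0 p) (hf1 p) hγ (by linarith) hη0.le hδU τ
      calc _ = (𝔼 i, if τ i = true ∧ Biased γ (α p τ i) then F p τ else 0) * G p τ := by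
            rw [Finset.expect_mul]
            refine Finset.expect_congr rfl fun i _ => ?_
            by_cases h : τ i = true
            · by_cases hb : Biased γ (α p τ i) <;> simp [h, hb, hFGΨ p τ i h]
            · simp [h]
        _ ≤ (η * F p τ + ξ) * G p τ := mul_le_mul_of_nonneg_right h2 (hG0 _ _)
        _ ≤ η * (F p τ * G p τ) + ξ := by nlinarith [hG1 p τ]
    calc _ ≤ 𝔼 p, 𝔼 τ, (η * (F p τ * G p τ) + ξ) :=
          Finset.expect_le_expect fun p _ => Finset.expect_le_expect fun τ _ => h1 p τ
      _ = η * M + ξ := by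
          simp only [Finset.expect_add_distrib, Fintype.expect_const, hM, Finset.mul_expect]
  have hbM : 1 / 2 * E (fun p τ i => if Biased γ (β p τ i) then Φ p τ i else 0) ≤ η * M + ξ := by
    rw [← hEactive false _ fun p τ i c => by simp only [hβu, hΦu]]
    have h1 : ∀ p τ, 𝔼 i, (if τ i = false then (if Biased γ (β p τ i) then Φ p τ i else 0) else 0)
        ≤ η * (F p τ * G p τ) + ξ := by
      intro p τ
      have h2 := expect_biased_le oM (g p) (hg0 p) (hg1 p) hγ (by linarith) hη0.le hδM
        (fun j => !τ j)
      calc _ = F p τ * 𝔼 i, if (!τ i) = true ∧ Biased γ (β p τ i) then G p τ else 0 := by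
            rw [Finset.mul_expect]
            refine Finset.expect_congr rfl fun i _ => ?_
            by_cases h : τ i = false
            · by_cases hb : Biased γ (β p τ i) <;> simp [h, hb, hFGΦ p τ i h]
            · simp [h]
        _ ≤ F p τ * (η * G p τ + ξ) := mul_le_mul_of_nonneg_left h2 (hF0 _ _)
        _ ≤ η * (F p τ * G p τ) + ξ := by nlinarith [hF1 p τ]
    calc _ ≤ 𝔼 p, 𝔼 τ, (η * (F p τ * G p τ) + ξ) :=
          Finset.expect_le_expect fun p _ => Finset.expect_le_expect fun τ _ => h1 p τ
      _ = η * M + ξ := by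
          simp only [Finset.expect_add_distrib, Fintype.expect_const, hM, Finset.mul_expect]
  have hΨle : E Ψ ≤ E (fun p τ i => if Biased γ (α p τ i) then Ψ p τ i else 0)
      + 2 * KM * E Φ := by
    rw [← hEmul, ← hEadd]
    refine hEmono _ _ fun p τ i => ?_
    by_cases hb : Biased γ (α p τ i)
    · rw [if_pos hb]
      have := hΦ0 p τ i
      have : 0 ≤ 2 * KM * Φ p τ i := by positivity
      linarith
    · rw [if_neg hb, zero_add]
      have h1 := expect_le_two_mul_of_not_biased hγ1 (hα0 p τ i) hb oU
      have h2 := le_card_mul_expect (β p τ i) (hβ0 p τ i) oM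
      calc Ψ p τ i ≤ (2 * α p τ i oU) * (KM * 𝔼 b, β p τ i b) :=
            mul_le_mul h1 h2 (hβ0 _ _ _ _) (by have := hα0 p τ i oU; positivity)
        _ = 2 * KM * Φ p τ i := by simp only [hΦ]; ring
  have hMle : M ≤ 2 * ξ + (2 * KM + 1) * E Φ := by
    have hM0 : 0 ≤ M := Finset.expect_nonneg fun p _ => Finset.expect_nonneg fun τ _ =>
      mul_nonneg (hF0 p τ) (hG0 p τ)
    nlinarith
  have hbad : E (fun p τ i => if Biased γ (α p τ i) ∨ Biased γ (β p τ i) then Φ p τ i else 0) ≤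
      E (fun p τ i => if Biased γ (β p τ i) then Φ p τ i else 0) +
      2 * KU * E (fun p τ i => if Biased γ (α p τ i) then Ψ p τ i else 0) := by
    rw [← hEmul, ← hEadd]
    refine hEmono _ _ fun p τ i => ?_
    have h0 := hΦ0 p τ i
    have h0' : 0 ≤ 2 * KU * Ψ p τ i := by have := hΨ0 p τ i; positivity
    by_cases hb : Biased γ (β p τ i)
    · simp only [hb, or_true, if_true]
      split_ifs <;> linarith
    · by_cases ha : Biased γ (α p τ i)
      · simp only [ha, hb, or_false, if_true, if_false, zero_add]
        have h1 := expect_le_two_mul_of_not_biased hγ1 (hβ0 p τ i) hb oM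
        have h2 := le_card_mul_expect (α p τ i) (hα0 p τ i) oU
        calc Φ p τ i ≤ (KU * 𝔼 a, α p τ i a) * (2 * β p τ i oM) :=
              mul_le_mul h2 h1 (hβm _ _ _) (by have := hαm p τ i; positivity)
          _ = 2 * KU * Ψ p τ i := by simp only [hΨ]; ring
      · simp [ha, hb]
  have hEΦ : 0 ≤ E Φ := Finset.expect_nonneg fun p _ => Finset.expect_nonneg fun τ _ =>
    Finset.expect_nonneg fun i _ => hΦ0 p τ i
  calc _ ≤ _ := hbad
    _ ≤ 2 * (η * M + ξ) + 2 * KU * (2 * (η * M + ξ)) := by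
        have : 2 * KU * E (fun p τ i => if Biased γ (α p τ i) then Ψ p τ i else 0) ≤
          2 * KU * (2 * (η * M + ξ)) := mul_le_mul_of_nonneg_left (by linarith) (by positivity)
        linarith
    _ = (2 + 4 * KU) * (η * M + ξ) := by ring
    _ ≤ (2 + 4 * KU) * (η * (2 * ξ + (2 * KM + 1) * E Φ) + ξ) := by gcongr
    _ = ((2 + 4 * KU) * (2 * KM + 1) * η) * E Φ + (2 + 4 * KU) * ((2 * η + 1) * ξ) := by ring
    _ ≤ γ' * E Φ + (2 + 4 * KU) * (2 * ξ) := by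
        have : (2 * η + 1) * ξ ≤ 2 * ξ := mul_le_mul_of_nonneg_right (by linarith) hξ0.le
        gcongr
    _ = γ' * E Φ + (2 + 4 * KU) * 2 * ξ := by ring

section Triples

variable {X : Type*} [Fintype X] [DecidableEq X]

omit [Fintype X] in
/-- A family of small nonempty sets has many disjoint members or a small hitting set. -/
lemma exists_disjoint_or_hitting (𝒜 : Finset (Finset X)) (s : ℕ)
    (hs : ∀ h ∈ 𝒜, h.card ≤ s) (hne : ∀ h ∈ 𝒜, h.Nonempty) (ν : ℕ) :
    (∃ 𝓑 ⊆ 𝒜, (𝓑 : Set (Finset X)).PairwiseDisjoint id ∧ 𝓑.card = ν) ∨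
      ∃ L : Finset X, L.card ≤ s * ν ∧ ∀ h ∈ 𝒜, ∃ x ∈ h, x ∈ L := by
  induction ν with
  | zero => exact Or.inl ⟨∅, by simp, by simp, rfl⟩
  | succ ν ih =>
    rcases ih with ⟨𝓑, h𝓑, hdisj, hcard⟩ | ⟨L, hL, hhit⟩
    · by_cases hall : ∀ h ∈ 𝒜, ∃ x ∈ h, x ∈ 𝓑.biUnion id
      · refine Or.inr ⟨𝓑.biUnion id, ?_, hall⟩
        calc _ ≤ 𝓑.card * s := Finset.card_biUnion_le_card_mul _ _ _ fun h hh => hs h (h𝓑 hh)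
          _ ≤ s * (ν + 1) := by rw [hcard]; nlinarith
      · push Not at hall
        obtain ⟨h, hh, hx⟩ := hall
        have hd : ∀ b ∈ 𝓑, Disjoint h b := fun b hb => Finset.disjoint_left.2 fun x hxh hxb =>
          hx x hxh (Finset.mem_biUnion.2 ⟨b, hb, hxb⟩)
        have hnot : h ∉ 𝓑 := fun hmem => by
          obtain ⟨x, hxh⟩ := hne h hh
          exact Finset.disjoint_left.1 (hd h hmem) hxh hxh
        refine Or.inl ⟨insert h 𝓑, Finset.insert_subset hh h𝓑, ?_, ?_⟩
        · rw [Finset.coe_insert]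
          exact hdisj.insert fun b hb _ => hd b hb
        · rw [Finset.card_insert_of_notMem hnot, hcard]
    · exact Or.inr ⟨L, hL.trans (by nlinarith), hhit⟩

/-- Few sets contain no member of a large disjoint family of sets of size at most three. -/
lemma card_avoiding_le (𝓑 : Finset (Finset X)) (hdisj : (𝓑 : Set (Finset X)).PairwiseDisjoint id)
    (h3 : ∀ h ∈ 𝓑, h.card ≤ 3) :
    8 ^ 𝓑.card * (Finset.univ.filter fun A : Finset X => ∀ h ∈ 𝓑, ¬ h ⊆ A).card ≤
      7 ^ 𝓑.card * 2 ^ Fintype.card X := by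
  induction 𝓑 using Finset.induction_on with
  | empty => simp
  | insert h 𝓑 hnot ih =>
    have hd : ∀ b ∈ 𝓑, Disjoint h b := fun b hb =>
      hdisj (by simp) (by simp [hb]) (fun he => hnot (he ▸ hb))
    have ih := ih (hdisj.subset (by simp)) fun b hb => h3 b (Finset.mem_insert_of_mem hb)
    set S := Finset.univ.filter fun A : Finset X => ∀ b ∈ 𝓑, ¬ b ⊆ A with hS
    have hsplit : (S.filter fun A => h ⊆ A).card + (S.filter fun A => ¬ h ⊆ A).card = S.card :=
      Finset.card_filter_add_card_filter_not _
    have hinj : S.card ≤ ((S.filter fun A => h ⊆ A) ×ˢ h.powerset).card := by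
      refine Finset.card_le_card_of_injOn (fun A => (A ∪ h, A ∩ h)) ?_ ?_
      · intro A hA
        have hA := (Finset.mem_filter.1 hA).2
        refine Finset.mem_product.2 ⟨?_, ?_⟩
        · refine Finset.mem_filter.2 ⟨Finset.mem_filter.2 ⟨Finset.mem_univ _, ?_⟩,
            Finset.subset_union_right⟩
          intro b hb hsub
          refine hA b hb fun x hx => ?_
          rcases Finset.mem_union.1 (hsub hx) with h1 | h1
          · exact h1
          · exact absurd hx (Finset.disjoint_left.1 (hd b hb) h1)
        · exact Finset.mem_powerset.2 Finset.inter_subset_right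
      · intro A _ B _ hAB
        have h1 : A ∪ h = B ∪ h := congrArg Prod.fst hAB
        have h2 : A ∩ h = B ∩ h := congrArg Prod.snd hAB
        ext x
        have h1 := Finset.ext_iff.1 h1 x
        have h2 := Finset.ext_iff.1 h2 x
        simp only [Finset.mem_union, Finset.mem_inter] at h1 h2
        tauto
    have hpow : h.powerset.card ≤ 8 := by
      rw [Finset.card_powerset]
      calc 2 ^ h.card ≤ 2 ^ 3 := Nat.pow_le_pow_right (by norm_num) (h3 h (by simp))
        _ = 8 := by norm_num
    have h8 : S.card ≤ (S.filter fun A => h ⊆ A).card * 8 := by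
      rw [Finset.card_product] at hinj
      exact hinj.trans (Nat.mul_le_mul_left _ hpow)
    have heq : (Finset.univ.filter fun A : Finset X => ∀ b ∈ insert h 𝓑, ¬ b ⊆ A)
        = S.filter fun A => ¬ h ⊆ A := by
      ext A
      simp only [hS, Finset.mem_filter, Finset.mem_univ, true_and, Finset.forall_mem_insert]
      tauto
    rw [heq, Finset.card_insert_of_notMem hnot, pow_succ, pow_succ]
    have h7 : 8 * (S.filter fun A => ¬ h ⊆ A).card ≤ 7 * S.card := by omega
    calc 8 ^ 𝓑.card * 8 * (S.filter fun A => ¬ h ⊆ A).card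
        = 8 ^ 𝓑.card * (8 * (S.filter fun A => ¬ h ⊆ A).card) := by ring
      _ ≤ 8 ^ 𝓑.card * (7 * S.card) := Nat.mul_le_mul_left _ h7
      _ = 7 * (8 ^ 𝓑.card * S.card) := by ring
      _ ≤ 7 * (7 ^ 𝓑.card * 2 ^ Fintype.card X) := Nat.mul_le_mul_left _ ih
      _ = _ := by ring

/-- The sets of even size that avoid `e`. -/
def evenSets (e : X) : Finset (Finset X) :=
  Finset.univ.filter fun A => e ∉ A ∧ Even A.card

lemma empty_mem_evenSets (e : X) : ∅ ∈ evenSets e := by simp [evenSets]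

lemma evenSets_nonempty (e : X) : (evenSets e).Nonempty := ⟨∅, empty_mem_evenSets e⟩

lemma four_mul_card_evenSets (e : X) (h2 : 2 ≤ Fintype.card X) :
    4 * (evenSets e).card = 2 ^ Fintype.card X := by
  have hne : (Finset.univ.erase e : Finset X).Nonempty := by
    rw [← Finset.card_pos, Finset.card_erase_of_mem (Finset.mem_univ _), Finset.card_univ]
    omega
  have h := Finset.sum_powerset_neg_one_pow_card_of_nonempty hne
  rw [← Finset.sum_filter_add_sum_filter_not _ fun A : Finset X => Even A.card] at h
  have heven : evenSets e = (Finset.univ.erase e).powerset.filter fun A => Even A.card := by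
    ext A
    simp [evenSets, Finset.subset_erase]
  rw [← heven] at h
  have h1 : ∑ A ∈ evenSets e, (-1 : ℤ) ^ A.card = (evenSets e).card := by
    rw [Finset.sum_congr rfl fun A hA => (Finset.mem_filter.1 hA).2.2.neg_one_pow]
    simp
  have h3 : ∑ A ∈ (Finset.univ.erase e).powerset.filter (fun A => ¬ Even A.card),
      (-1 : ℤ) ^ A.card =
      -((Finset.univ.erase e).powerset.filter (fun A => ¬ Even A.card)).card := by
    rw [Finset.sum_congr rfl fun A hA =>
      (Nat.not_even_iff_odd.1 (Finset.mem_filter.1 hA).2).neg_one_pow]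
    simp
  rw [h1, h3] at h
  have h4 := Finset.card_filter_add_card_filter_not (s := (Finset.univ.erase e).powerset)
    (fun A : Finset X => Even A.card)
  rw [← heven, Finset.card_powerset, Finset.card_erase_of_mem (Finset.mem_univ _),
    Finset.card_univ] at h4
  obtain ⟨k, hk⟩ : ∃ k, Fintype.card X = k + 1 := ⟨Fintype.card X - 1, by omega⟩
  rw [hk, Nat.add_sub_cancel] at h4
  rw [hk, pow_succ]
  omega

open Classical in
/-- The probability that a random even set `A` avoiding `e` is such that both `A ∪ {e}` and the
complement of `A` contain a member of `𝒢`. -/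
noncomputable def splitProb (𝒢 : Finset (Finset X)) (e : X) : ℝ :=
  𝔼 A ∈ evenSets e, if (∃ H ∈ 𝒢, H ⊆ insert e A) ∧ (∃ H ∈ 𝒢, H ⊆ Aᶜ) then 1 else 0

lemma splitProb_nonneg (𝒢 : Finset (Finset X)) (e : X) : 0 ≤ splitProb 𝒢 e :=
  Finset.expect_nonneg fun _ _ => by split_ifs <;> norm_num

lemma le_splitProb (𝒢 : Finset (Finset X)) (e : X) (h2 : 2 ≤ Fintype.card X)
    (𝓑 : Finset (Finset X)) (hdisj : (𝓑 : Set (Finset X)).PairwiseDisjoint id)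
    (h3 : ∀ h ∈ 𝓑, h.card ≤ 3)
    (h𝓑 : ∀ h ∈ 𝓑, ∃ H ∈ 𝒢, H ⊆ insert e h) :
    1 - 8 * (7 / 8 : ℝ) ^ 𝓑.card ≤ splitProb 𝒢 e := by
  classical
  set S := Finset.univ.filter fun A : Finset X => ∀ h ∈ 𝓑, ¬ h ⊆ A with hS
  have hcount : (S.card : ℝ) ≤ (7 / 8 : ℝ) ^ 𝓑.card * 2 ^ Fintype.card X := by
    have h : (8 : ℝ) ^ 𝓑.card * S.card ≤ 7 ^ 𝓑.card * 2 ^ Fintype.card X := by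
      exact_mod_cast card_avoiding_le 𝓑 hdisj h3
    rw [div_pow, div_mul_eq_mul_div, le_div_iff₀ (by positivity)]
    linarith
  have hE4 : (4 : ℝ) * (evenSets e).card = 2 ^ Fintype.card X := by
    exact_mod_cast four_mul_card_evenSets e h2
  have hEpos : (0 : ℝ) < (evenSets e).card := by
    exact_mod_cast (evenSets_nonempty e).card_pos
  set p : Finset X → Prop :=
    fun A => (∃ H ∈ 𝒢, H ⊆ insert e A) ∧ (∃ H ∈ 𝒢, H ⊆ Aᶜ) with hp
  have hbad : ((evenSets e).filter fun A => ¬ p A).card ≤ S.card + S.card := by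
    have hsub : (evenSets e).filter (fun A => ¬ p A) ⊆ S ∪ S.image compl := by
      intro A hA
      obtain ⟨hAe, hnp⟩ := Finset.mem_filter.1 hA
      have heA : e ∉ A := (Finset.mem_filter.1 hAe).2.1
      by_contra hnot
      simp only [Finset.mem_union, not_or] at hnot
      refine hnp ⟨?_, ?_⟩
      · have h1 := hnot.1
        simp only [hS, Finset.mem_filter, Finset.mem_univ, true_and, not_forall, not_not] at h1
        obtain ⟨h, hh, hsub⟩ := h1
        obtain ⟨H, hH, hHe⟩ := h𝓑 h hh
        exact ⟨H, hH, hHe.trans (Finset.insert_subset_insert _ hsub)⟩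
      · have h1 : Aᶜ ∉ S := fun h => hnot.2 (Finset.mem_image.2 ⟨Aᶜ, h, compl_compl A⟩)
        simp only [hS, Finset.mem_filter, Finset.mem_univ, true_and, not_forall, not_not] at h1
        obtain ⟨h, hh, hsub⟩ := h1
        obtain ⟨H, hH, hHe⟩ := h𝓑 h hh
        exact ⟨H, hH, hHe.trans (Finset.insert_subset (Finset.mem_compl.2 heA) hsub)⟩
    exact (Finset.card_le_card hsub).trans
      ((Finset.card_union_le _ _).trans (Nat.add_le_add_left Finset.card_image_le _))
  have hgood : ((evenSets e).card : ℝ) ≤ ((evenSets e).filter p).card + 2 * S.card := by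
    have := Finset.card_filter_add_card_filter_not (s := evenSets e) p
    have h : (evenSets e).card ≤ ((evenSets e).filter p).card + 2 * S.card := by omega
    exact_mod_cast h
  have hval : splitProb 𝒢 e = ((evenSets e).filter p).card / (evenSets e).card := by
    rw [splitProb, Finset.expect_eq_sum_div_card, Finset.sum_boole]
  rw [hval, le_div_iff₀ hEpos]
  nlinarith

lemma expect_perm_apply_eq (x a : X) :
    𝔼 κ : Equiv.Perm X, (if κ x = a then (1 : ℝ) else 0) = 1 / Fintype.card X := by
  have hconst : ∀ b, 𝔼 κ : Equiv.Perm X, (if κ x = b then (1 : ℝ) else 0)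
      = 𝔼 κ : Equiv.Perm X, (if κ x = a then (1 : ℝ) else 0) := fun b => by
    refine Fintype.expect_equiv (Equiv.mulLeft (Equiv.swap b a)) _ _ fun κ => ?_
    have : (Equiv.swap b a) (κ x) = a ↔ κ x = b := by
      rw [← Equiv.eq_symm_apply, Equiv.symm_swap, Equiv.swap_apply_right]
    simp [this]
  have hsum : ∑ b, 𝔼 κ : Equiv.Perm X, (if κ x = b then (1 : ℝ) else 0) = 1 := by
    rw [← Finset.expect_sum_comm]
    simp
  have hX : (0 : ℝ) < Fintype.card X := by exact_mod_cast Fintype.card_pos_iff.2 ⟨x⟩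
  rw [Finset.sum_congr rfl fun b _ => hconst b, Finset.sum_const, nsmul_eq_mul,
    Finset.card_univ] at hsum
  rw [eq_div_iff hX.ne']
  linarith

lemma expect_perm_apply_pair_le {x y a b : X} (hxy : x ≠ y) (hab : a ≠ b) :
    𝔼 κ : Equiv.Perm X, (if κ x = a ∧ κ y = b then (1 : ℝ) else 0) ≤
      2 / (Fintype.card X : ℝ) ^ 2 := by
  set q := 𝔼 κ : Equiv.Perm X, (if κ x = a ∧ κ y = b then (1 : ℝ) else 0) with hq
  have hq0 : 0 ≤ q := Finset.expect_nonneg fun _ _ => by split_ifs <;> norm_num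
  have hconst : ∀ c ∈ Finset.univ.erase a,
      𝔼 κ : Equiv.Perm X, (if κ x = a ∧ κ y = c then (1 : ℝ) else 0) = q := fun c hc => by
    have hca : c ≠ a := Finset.ne_of_mem_erase hc
    refine Fintype.expect_equiv (Equiv.mulLeft (Equiv.swap c b)) _ _ fun κ => ?_
    have h1 : (Equiv.swap c b) (κ y) = b ↔ κ y = c := by
      rw [← Equiv.eq_symm_apply, Equiv.symm_swap, Equiv.swap_apply_right]
    have h2 : (Equiv.swap c b) (κ x) = a ↔ κ x = a := by
      rw [← Equiv.eq_symm_apply, Equiv.symm_swap,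
        Equiv.swap_apply_of_ne_of_ne hca.symm hab]
    simp [h1, h2]
  have hsum : ∑ c ∈ Finset.univ.erase a,
      𝔼 κ : Equiv.Perm X, (if κ x = a ∧ κ y = c then (1 : ℝ) else 0) = 1 / Fintype.card X := by
    rw [← expect_perm_apply_eq x a, ← Finset.expect_sum_comm]
    refine Finset.expect_congr rfl fun κ _ => ?_
    by_cases h : κ x = a
    · have : κ y ∈ Finset.univ.erase a :=
        Finset.mem_erase.2 ⟨fun hy => hxy (κ.injective (h.trans hy.symm)), Finset.mem_univ _⟩
      simp [h, (Finset.mem_erase.1 this).1]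
    · simp [h]
  rw [Finset.sum_congr rfl hconst, Finset.sum_const, nsmul_eq_mul,
    Finset.card_erase_of_mem (Finset.mem_univ _), Finset.card_univ] at hsum
  have h2 : 2 ≤ Fintype.card X := Fintype.one_lt_card_iff.2 ⟨x, y, hxy⟩
  have h2' : (2 : ℝ) ≤ Fintype.card X := by exact_mod_cast h2
  rw [Nat.cast_sub (by omega), Nat.cast_one] at hsum
  have hX : (0 : ℝ) < Fintype.card X := by linarith
  rw [le_div_iff₀ (by positivity)]
  rw [eq_div_iff hX.ne'] at hsum
  nlinarith

open Classical in
/-- A family of triples is mostly covered by those of its members that contain an element `e` such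
that a random split of the ground set sharing only `e` has a member of the family on both sides. -/
theorem exists_triple_density_le {γ : ℝ} (hγ : 0 < γ) (hγ1 : γ < 1) :
    ∃ C : ℝ, 0 < C ∧ ∀ (X : Type) [Fintype X] [DecidableEq X] (H₀ : Finset X)
      (𝒢 : Finset (Finset X)), H₀.card = 3 → (∀ H ∈ 𝒢, H.card = 3) →
      𝔼 κ : Equiv.Perm X, (if H₀.map κ.toEmbedding ∈ 𝒢 then (1 : ℝ) else 0) ≤
        3 / (1 - γ) * 𝔼 e, splitProb 𝒢 e + C / (Fintype.card X : ℝ) ^ 2 := by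
  obtain ⟨ν, hν⟩ : ∃ ν : ℕ, (7 / 8 : ℝ) ^ ν < γ / 8 :=
    exists_pow_lt_of_lt_one (by positivity) (by norm_num)
  have hpow : ∀ j, ν ≤ j → 1 - γ ≤ 1 - 8 * (7 / 8 : ℝ) ^ j := fun j hj => by
    have : (7 / 8 : ℝ) ^ j ≤ (7 / 8 : ℝ) ^ ν := pow_le_pow_of_le_one (by norm_num) (by norm_num) hj
    linarith
  refine ⟨(9 * (3 * ν) * (2 * ν) + 1) * 2, by positivity, ?_⟩
  intro X _ _ H₀ 𝒢 hH₀ h𝒢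
  have hk3 : 3 ≤ Fintype.card X := hH₀ ▸ Finset.card_le_univ H₀
  have hk3' : (3 : ℝ) ≤ Fintype.card X := by exact_mod_cast hk3
  have hX : Nonempty X := Fintype.card_pos_iff.1 (by omega)
  set k : ℝ := (Fintype.card X : ℝ) with hk
  have hrest : 0 ≤ ((9 * (3 * ν) * (2 * ν) + 1) * 2 : ℝ) / k ^ 2 := by positivity
  have h1γ : 0 < 1 - γ := by linarith
  rcases exists_disjoint_or_hitting 𝒢 3 (fun h hh => (h𝒢 h hh).le)
    (fun h hh => Finset.card_pos.1 (by rw [h𝒢 h hh]; norm_num)) ν with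
    ⟨𝓑, h𝓑, hdisj, hcard⟩ | ⟨L, hL, hhit⟩
  · have hall : ∀ e, 1 - γ ≤ splitProb 𝒢 e := fun e =>
      (hpow _ hcard.ge).trans (le_splitProb 𝒢 e (by omega) 𝓑 hdisj
        (fun h hh => (h𝒢 h (h𝓑 hh)).le) fun h hh => ⟨h, h𝓑 hh, Finset.subset_insert _ _⟩)
    have h1 : 1 - γ ≤ 𝔼 e, splitProb 𝒢 e :=
      Finset.le_expect Finset.univ_nonempty fun e _ => hall e
    have h2 : 𝔼 κ : Equiv.Perm X, (if H₀.map κ.toEmbedding ∈ 𝒢 then (1 : ℝ) else 0) ≤ 1 :=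
      Finset.expect_le Finset.univ_nonempty fun _ _ => by split_ifs <;> norm_num
    have h3 : 3 ≤ 3 / (1 - γ) * 𝔼 e, splitProb 𝒢 e := by
      rw [div_mul_eq_mul_div, le_div_iff₀ h1γ]
      linarith
    linarith
  · set link : X → Finset (Finset X) :=
      fun e => (𝒢.filter fun H => e ∈ H).image fun H => H.erase e with hlink
    have hlinkcard : ∀ e, ∀ h ∈ link e, h.card = 2 := by
      intro e h hh
      obtain ⟨H, hH, rfl⟩ := Finset.mem_image.1 hh
      obtain ⟨hH, heH⟩ := Finset.mem_filter.1 hH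
      rw [Finset.card_erase_of_mem heH, h𝒢 H hH]
    have hlinkdich := fun e => exists_disjoint_or_hitting (link e) 2
      (fun h hh => (hlinkcard e h hh).le)
      (fun h hh => Finset.card_pos.1 (by rw [hlinkcard e h hh]; norm_num)) ν
    set heavy : Finset X := Finset.univ.filter fun e =>
      ∃ 𝓑 ⊆ link e, (𝓑 : Set (Finset X)).PairwiseDisjoint id ∧ 𝓑.card = ν with hheavy
    have hlight : ∀ e, ∃ L' : Finset X, L'.card ≤ 2 * ν ∧
        (e ∉ heavy → ∀ h ∈ link e, ∃ x ∈ h, x ∈ L') := by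
      intro e
      rcases hlinkdich e with h | ⟨L', hL', hhit'⟩
      · exact ⟨∅, by simp, fun hne => absurd (by simpa [hheavy] using h) hne⟩
      · exact ⟨L', hL', fun _ => hhit'⟩
    choose L' hL'card hL' using hlight
    have hsplit : ∀ e ∈ heavy, 1 - γ ≤ splitProb 𝒢 e := by
      intro e he
      obtain ⟨𝓑, h𝓑, hdisj, hcard⟩ := (Finset.mem_filter.1 he).2
      have hmem : ∀ h ∈ 𝓑, ∃ H ∈ 𝒢, e ∈ H ∧ H.erase e = h := fun h hh => by
        obtain ⟨H, hH, hHe⟩ := Finset.mem_image.1 (h𝓑 hh)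
        exact ⟨H, (Finset.mem_filter.1 hH).1, (Finset.mem_filter.1 hH).2, hHe⟩
      refine (hpow _ hcard.ge).trans (le_splitProb 𝒢 e (by omega) 𝓑 hdisj ?_ ?_)
      · exact fun h hh => (hlinkcard e h (h𝓑 hh)).le.trans (by norm_num)
      · intro h hh
        obtain ⟨H, hH, heH, rfl⟩ := hmem h hh
        exact ⟨H, hH, (Finset.insert_erase heH).ge⟩
    have hmean : (1 - γ) * heavy.card / k ≤ 𝔼 e, splitProb 𝒢 e := by
      rw [Fintype.expect_eq_sum_div_card]
      refine div_le_div_of_nonneg_right ?_ (by positivity)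
      calc (1 - γ) * heavy.card = ∑ _e ∈ heavy, (1 - γ) := by
            rw [Finset.sum_const, nsmul_eq_mul]; ring
        _ ≤ ∑ e ∈ heavy, splitProb 𝒢 e := Finset.sum_le_sum hsplit
        _ ≤ ∑ e, splitProb 𝒢 e := Finset.sum_le_sum_of_subset_of_nonneg (Finset.subset_univ _)
            fun e _ _ => splitProb_nonneg 𝒢 e
    set pairs := (H₀ ×ˢ H₀).filter fun xy => xy.1 ≠ xy.2 with hpairs
    set spots := (L.sigma L').filter fun ea => ea.1 ≠ ea.2 with hspots
    have hpt : ∀ κ : Equiv.Perm X, (if H₀.map κ.toEmbedding ∈ 𝒢 then (1 : ℝ) else 0) ≤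
        (∑ x ∈ H₀, ∑ e ∈ heavy, if κ x = e then (1 : ℝ) else 0) +
        ∑ xy ∈ pairs, ∑ ea ∈ spots, if κ xy.1 = ea.1 ∧ κ xy.2 = ea.2 then (1 : ℝ) else 0 := by
      intro κ
      have hn1 : ∀ x ∈ H₀, 0 ≤ ∑ e ∈ heavy, if κ x = e then (1 : ℝ) else 0 :=
        fun x _ => Finset.sum_nonneg fun _ _ => by split_ifs <;> norm_num
      have hn2 : ∀ xy ∈ pairs, 0 ≤ ∑ ea ∈ spots,
          if κ xy.1 = ea.1 ∧ κ xy.2 = ea.2 then (1 : ℝ) else 0 :=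
        fun xy _ => Finset.sum_nonneg fun _ _ => by split_ifs <;> norm_num
      split_ifs with hmem
      · obtain ⟨e, heH, heL⟩ := hhit _ hmem
        obtain ⟨x, hx, rfl⟩ := Finset.mem_map.1 heH
        by_cases hhv : κ x ∈ heavy
        · have h1 : (1 : ℝ) ≤ ∑ x ∈ H₀, ∑ e ∈ heavy, if κ x = e then (1 : ℝ) else 0 := by
            refine le_trans ?_ (Finset.single_le_sum hn1 hx)
            simp [hhv]
          linarith [Finset.sum_nonneg hn2]
        · have hl : (H₀.map κ.toEmbedding).erase (κ x) ∈ link (κ x) :=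
            Finset.mem_image.2 ⟨_, Finset.mem_filter.2 ⟨hmem, heH⟩, rfl⟩
          obtain ⟨a, ha, haL⟩ := hL' (κ x) hhv _ hl
          obtain ⟨hne, ha⟩ := Finset.mem_erase.1 ha
          obtain ⟨y, hy, rfl⟩ := Finset.mem_map.1 ha
          have hxy : x ≠ y := fun h => hne (by rw [h]; rfl)
          have hp : (x, y) ∈ pairs := Finset.mem_filter.2 ⟨Finset.mk_mem_product hx hy, hxy⟩
          have hs : (⟨κ x, κ y⟩ : Σ _ : X, X) ∈ spots :=
            Finset.mem_filter.2 ⟨Finset.mem_sigma.2 ⟨heL, haL⟩, fun h => hne h.symm⟩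
          have h1 : (1 : ℝ) ≤ ∑ xy ∈ pairs, ∑ ea ∈ spots,
              if κ xy.1 = ea.1 ∧ κ xy.2 = ea.2 then (1 : ℝ) else 0 := by
            refine le_trans ?_ (Finset.single_le_sum hn2 hp)
            refine le_trans ?_ (Finset.single_le_sum
              (f := fun ea : Σ _ : X, X => if κ x = ea.1 ∧ κ y = ea.2 then (1 : ℝ) else 0)
              (fun _ _ => by split_ifs <;> norm_num) hs)
            simp
          linarith [Finset.sum_nonneg hn1]
      · exact add_nonneg (Finset.sum_nonneg hn1) (Finset.sum_nonneg hn2)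
    have hpairscard : (pairs.card : ℝ) ≤ 9 := by
      have : pairs.card ≤ 9 := (Finset.card_filter_le _ _).trans (by
        rw [Finset.card_product, hH₀])
      exact_mod_cast this
    have hspotscard : (spots.card : ℝ) ≤ 3 * ν * (2 * ν) := by
      have : spots.card ≤ 3 * ν * (2 * ν) := (Finset.card_filter_le _ _).trans (by
        rw [Finset.card_sigma]
        exact (Finset.sum_le_card_nsmul _ _ _ fun e _ => hL'card e).trans
          (Nat.mul_le_mul_right _ hL))
      exact_mod_cast this
    calc 𝔼 κ : Equiv.Perm X, (if H₀.map κ.toEmbedding ∈ 𝒢 then (1 : ℝ) else 0)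
        ≤ _ := Finset.expect_le_expect fun κ _ => hpt κ
      _ = (∑ x ∈ H₀, ∑ e ∈ heavy, 1 / k) + ∑ xy ∈ pairs, ∑ ea ∈ spots,
          𝔼 κ : Equiv.Perm X, if κ xy.1 = ea.1 ∧ κ xy.2 = ea.2 then (1 : ℝ) else 0 := by
          rw [Finset.expect_add_distrib]
          simp only [Finset.expect_sum_comm, expect_perm_apply_eq, hk]
      _ ≤ (∑ x ∈ H₀, ∑ e ∈ heavy, 1 / k) + ∑ xy ∈ pairs, ∑ ea ∈ spots, 2 / k ^ 2 := by
          refine add_le_add_right (Finset.sum_le_sum fun xy hxy => Finset.sum_le_sum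
            fun ea hea => ?_) _
          exact expect_perm_apply_pair_le (Finset.mem_filter.1 hxy).2 (Finset.mem_filter.1 hea).2
      _ = 3 / (1 - γ) * ((1 - γ) * heavy.card / k) + pairs.card * spots.card * (2 / k ^ 2) := by
          simp only [Finset.sum_const, nsmul_eq_mul, hH₀]
          field_simp
          push_cast
          ring
      _ ≤ 3 / (1 - γ) * (𝔼 e, splitProb 𝒢 e) +
          9 * (3 * ν * (2 * ν)) * (2 / k ^ 2) := by gcongr
      _ ≤ _ := by
          refine add_le_add_right ?_ _
          rw [mul_div_assoc', mul_comm]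
          refine div_le_div_of_nonneg_right ?_ (by positivity)
          nlinarith

end Triples

section Local

/-- The elements of a block: `m` pairs. -/
abbrev Block (m : ℕ) : Type := Fin m × Bool

/-- A block together with the three common elements. -/
abbrev Core (m : ℕ) : Type := Fin 3 ⊕ Block m

/-- The involutions of a block. -/
abbrev BlockInv (m : ℕ) : Type := {s : Block m → Block m // Function.Involutive s}

/-- The fixed-point-free involution that exchanges the members of each pair. -/
def blockFlip (m : ℕ) : BlockInv m := ⟨fun q => (q.1, !q.2), fun q => by simp⟩

/-- The three common elements. -/
def coreTriple (m : ℕ) : Finset (Core m) := Finset.univ.map Function.Embedding.inl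

/-- The three common elements and the pairs selected by `a`. -/
def coreSet {m : ℕ} (a : Fin m → Bool) : Finset (Core m) :=
  Finset.univ.filter fun x => Sum.elim (fun _ => true) (fun q : Block m => a q.1) x = true

noncomputable instance (m : ℕ) : Fintype (BlockInv m) := Fintype.ofFinite _

instance (m : ℕ) : Nonempty (BlockInv m) := ⟨blockFlip m⟩

variable {m : ℕ}

lemma card_coreTriple : (coreTriple m).card = 3 := by simp [coreTriple]

lemma coreSet_false : coreSet (fun _ : Fin m => false) = coreTriple m := by
  ext x
  rcases x with x | x <;> simp [coreSet, coreTriple]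

lemma coreSet_true : coreSet (fun _ : Fin m => true) = Finset.univ := by
  ext x
  rcases x with x | x <;> simp [coreSet]

/-- Translation of a function of sets by a permutation. -/
def twistSet {X : Type*} (κ : Equiv.Perm X) (u : Finset X → ℝ) : Finset X → ℝ :=
  fun A => u (A.map κ.toEmbedding)

/-- Translation of a function of self-maps by a permutation. -/
def twistMap {X : Type*} (κ : Equiv.Perm X) (v : (X → X) → ℝ) : (X → X) → ℝ :=
  fun s => v (κ ∘ s ∘ κ.symm)

/-- The functions `u` and `v` are constant, up to the factor `θ`, on the sets that are the union of
`H` and a set of even size, and on the involutions that fix `H` pointwise. -/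
def LocallyUniform {X : Type*} [Fintype X] (θ : ℝ) (u : Finset X → ℝ) (v : (X → X) → ℝ)
    (H : Finset X) : Prop :=
  (∀ S, Disjoint H S → Even S.card → ∀ A, (∀ x, x ∈ A ↔ x ∈ H ∨ x ∈ S) →
    u A ≤ θ * u Finset.univ ∧ u Finset.univ ≤ θ * u A) ∧
  ∀ s : X → X, Function.Involutive s → (∀ x ∈ H, s x = x) → v s ≤ θ * v id ∧ v id ≤ θ * v s

lemma LocallyUniform.of_twist {X : Type*} [Fintype X] {θ : ℝ} {u : Finset X → ℝ}
    {v : (X → X) → ℝ} {H : Finset X} {κ : Equiv.Perm X}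
    (h : LocallyUniform θ (twistSet κ u) (twistMap κ v) H) :
    LocallyUniform θ u v (H.map κ.toEmbedding) := by
  refine ⟨fun S hHS hS A hA => ?_, fun s hs hfix => ?_⟩
  · have key := h.1 (S.map κ.symm.toEmbedding) ?_ (by simpa using hS)
      (A.map κ.symm.toEmbedding) ?_
    · simpa [twistSet, Finset.map_map, Finset.map_univ_equiv] using key
    · rw [Finset.disjoint_left] at hHS ⊢
      intro x hx hxS
      obtain ⟨y, hy, rfl⟩ := Finset.mem_map.1 hxS
      exact hHS (Finset.mem_map.2 ⟨_, hx, by simp⟩) hy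
    · intro x
      have := hA (κ x)
      simpa [Finset.mem_map_equiv] using this
  · have key := h.2 (κ.symm ∘ s ∘ κ) (fun x => by simp [hs (κ x)]) (fun x hx => by
      simp [hfix (κ x) (Finset.mem_map.2 ⟨x, hx, rfl⟩)])
    have h1 : κ ∘ (κ.symm ∘ s ∘ κ) ∘ κ.symm = s := by funext x; simp
    have h2 : κ ∘ id ∘ κ.symm = id := by funext x; simp
    simpa only [twistMap, h1, h2] using key

/-- One of the marginals on the core is biased. -/
def LocallyBiased (γ : ℝ) (u : Finset (Core m) → ℝ) (v : (Core m → Core m) → ℝ) : Prop :=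
  Biased γ (fun a : Fin m → Bool => u (coreSet a)) ∨
    Biased γ (fun b : BlockInv m => v (Sum.map id b.1))

/-- The weight of `u`, `v` on the triple of common elements and the involutions fixing it. -/
noncomputable def coreWeight (u : Finset (Core m) → ℝ) (v : (Core m → Core m) → ℝ) : ℝ :=
  u (coreTriple m) * 𝔼 b : BlockInv m, v (Sum.map id b.1)

/-- The extension of a permutation of the block to the core. -/
abbrev corePerm (π : Equiv.Perm (Block m)) : Equiv.Perm (Core m) := Equiv.sumCongr (Equiv.refl _) π

lemma coreWeight_twist (π : Equiv.Perm (Block m)) (u : Finset (Core m) → ℝ)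
    (v : (Core m → Core m) → ℝ) :
    coreWeight (twistSet (corePerm π) u) (twistMap (corePerm π) v) = coreWeight u v := by
  have h1 : (coreTriple m).map (corePerm π).toEmbedding = coreTriple m := by
    ext x
    rcases x with x | x <;> simp [coreTriple]
  let conj : BlockInv m ≃ BlockInv m :=
    { toFun := fun b => ⟨π ∘ b.1 ∘ π.symm, fun x => by simp [b.2 (π.symm x)]⟩
      invFun := fun b => ⟨π.symm ∘ b.1 ∘ π, fun x => by simp [b.2 (π x)]⟩
      left_inv := fun b => by ext x <;> simp
      right_inv := fun b => by ext x <;> simp }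
  rw [coreWeight, coreWeight, twistSet, h1]
  congr 1
  refine Fintype.expect_equiv conj _ _ fun b => ?_
  simp only [twistMap]
  congr 1
  funext x
  rcases x with x | x <;> simp [conj]

lemma exists_perm_map_eq {X : Type*} [Fintype X] [DecidableEq X] {A B : Finset X}
    (h : A.card = B.card) : ∃ π : Equiv.Perm X, A.map π.toEmbedding = B := by
  obtain ⟨e⟩ : Nonempty (A ≃ B) := Fintype.card_eq.1 (by simpa using h)
  refine ⟨e.extendSubtype, Finset.eq_of_subset_of_card_le ?_ (by simp [h])⟩
  intro x hx
  obtain ⟨y, hy, rfl⟩ := Finset.mem_map.1 hx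
  exact Equiv.extendSubtype_mem e y hy

lemma exists_coreSet_map_eq {S : Finset (Core m)} (hS : Disjoint (coreTriple m) S)
    (heven : Even S.card) : ∃ (a : Fin m → Bool) (π : Equiv.Perm (Block m)),
      ∀ x, x ∈ (coreSet a).map (corePerm π).toEmbedding ↔ x ∈ coreTriple m ∨ x ∈ S := by
  classical
  set T : Finset (Block m) := Finset.univ.filter fun q => Sum.inr q ∈ S with hT
  have hTS : T.card = S.card := by
    have : S = T.map Function.Embedding.inr := by
      ext x
      rcases x with x | x
      · simp only [Finset.mem_map, Function.Embedding.inr_apply, reduceCtorEq, and_false,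
          exists_false, iff_false]
        exact fun hx => Finset.disjoint_left.1 hS (by simp [coreTriple]) hx
      · simp [hT]
    rw [this, Finset.card_map]
  obtain ⟨k, hk⟩ := heven
  have hle : T.card ≤ m * 2 := (Finset.card_le_univ T).trans (by simp)
  obtain ⟨R, hR⟩ : ∃ R : Finset (Fin m), R.card = k := by
    obtain ⟨R, -, hR⟩ := Finset.exists_subset_card_eq (s := (Finset.univ : Finset (Fin m)))
      (n := k) (by simp; omega)
    exact ⟨R, hR⟩
  have hcard : (R ×ˢ (Finset.univ : Finset Bool)).card = T.card := by
    rw [Finset.card_product, hR, hTS, hk]; simp; ring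
  obtain ⟨π, hπ⟩ := exists_perm_map_eq hcard
  refine ⟨fun i => decide (i ∈ R), π, fun x => ?_⟩
  rw [Finset.mem_map_equiv]
  rcases x with x | x
  · simp [coreSet, coreTriple]
  · have h1 : x ∈ T ↔ (π.symm x).1 ∈ R := by
      rw [← hπ, Finset.mem_map_equiv]; simp
    have h2 : x ∈ T ↔ Sum.inr x ∈ S := by simp [hT]
    rw [h2] at h1
    simp [coreSet, coreTriple, h1]

lemma ratio_le_of_not_biased {Ω : Type*} [Fintype Ω] {γ : ℝ} (hγ : 0 < γ) (hγ1 : γ < 1)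
    {p : Ω → ℝ} (h : ¬ Biased γ p) (a b : Ω) : p a ≤ (1 + γ) / (1 - γ) * p b := by
  have ha := (abs_le.1 (abs_sub_le_of_not_biased h a)).2
  have hb := (abs_le.1 (abs_sub_le_of_not_biased h b)).1
  rw [div_mul_eq_mul_div, le_div_iff₀ (by linarith)]
  nlinarith

/-- If `u`, `v` are not uniform around the common triple, this is witnessed by a biased marginal
after a permutation of the block. -/
lemma exists_locallyBiased {γ : ℝ} (hγ : 0 < γ) (hγ1 : γ < 1) {u : Finset (Core m) → ℝ}
    {v : (Core m → Core m) → ℝ}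
    (h : ¬ LocallyUniform ((1 + γ) / (1 - γ)) u v (coreTriple m)) :
    ∃ π : Equiv.Perm (Block m),
      LocallyBiased γ (twistSet (corePerm π) u) (twistMap (corePerm π) v) := by
  by_contra! hnot
  refine h ⟨fun S hS heven A hA => ?_, fun s hs hfix => ?_⟩
  · obtain ⟨a, π, haπ⟩ := exists_coreSet_map_eq hS heven
    have hA : A = (coreSet a).map (corePerm π).toEmbedding := by
      ext x; rw [hA, haπ]
    have hnb := fun hb => hnot π (Or.inl hb)
    have huniv : Finset.univ = (coreSet fun _ : Fin m => true).map (corePerm π).toEmbedding := by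
      rw [coreSet_true, Finset.map_univ_equiv]
    rw [hA, huniv]
    exact ⟨ratio_le_of_not_biased hγ hγ1 hnb a _, ratio_le_of_not_biased hγ hγ1 hnb _ a⟩
  · have hnb := fun hb => hnot (Equiv.refl _) (Or.inr hb)
    have hinr : ∀ q : Block m, ∃ q', s (Sum.inr q) = Sum.inr q' := by
      intro q
      rcases hsq : s (Sum.inr q) with x | x
      · have h1 := hs (Sum.inr q)
        rw [hsq, hfix (Sum.inl x) (by simp [coreTriple])] at h1
        exact absurd h1 (by simp)
      · exact ⟨x, rfl⟩
    choose b hb using hinr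
    have hbinv : Function.Involutive b := fun q => by
      have h1 := hs (Sum.inr q)
      rw [hb, hb] at h1
      exact Sum.inr_injective h1
    have hsb : s = Sum.map id b := by
      funext x
      rcases x with x | x
      · simpa using hfix (Sum.inl x) (by simp [coreTriple])
      · simpa using hb x
    have htw : ∀ t, twistMap (corePerm (Equiv.refl (Block m))) v t = v t := by
      intro t
      rw [twistMap]
      congr 1
      funext x
      simp [corePerm]
    have h1 := ratio_le_of_not_biased hγ hγ1 hnb ⟨b, hbinv⟩ ⟨id, fun _ => rfl⟩
    have h2 := ratio_le_of_not_biased hγ hγ1 hnb ⟨id, fun _ => rfl⟩ ⟨b, hbinv⟩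
    simp only [htw, Sum.map_id_id] at h1 h2
    rw [hsb]
    exact ⟨h1, h2⟩

lemma exists_involutive_support {X : Type*} [DecidableEq X] (A : Finset X)
    (hA : Even A.card) : ∃ s : X → X, Function.Involutive s ∧ ∀ x, s x = x ↔ x ∉ A := by
  obtain ⟨k, hk⟩ := hA
  obtain ⟨e⟩ : Nonempty (A ≃ Block k) := Fintype.card_eq.1 (by simp [hk]; ring)
  have hs : ∀ x (hx : x ∈ A), ((e.symm ((blockFlip k).1 (e ⟨x, hx⟩))) : X) ≠ x := by
    intro x hx heq
    have h1 : e.symm ((blockFlip k).1 (e ⟨x, hx⟩)) = ⟨x, hx⟩ := Subtype.ext heq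
    rw [Equiv.symm_apply_eq] at h1
    have h2 := congrArg Prod.snd h1
    simp [blockFlip] at h2
  refine ⟨fun x => if hx : x ∈ A then e.symm ((blockFlip k).1 (e ⟨x, hx⟩)) else x, fun x => ?_,
    fun x => ?_⟩
  · by_cases hx : x ∈ A
    · simp [hx, (blockFlip k).2 (e ⟨x, hx⟩)]
    · simp [hx]
  · by_cases hx : x ∈ A
    · simpa [hx] using hs x hx
    · simp [hx]

/-- An involution that moves exactly the elements of `A`, for `A` of even size. -/
noncomputable def mover {X : Type*} [DecidableEq X] (A : Finset X) : X → X :=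
  open Classical in if h : Even A.card then (exists_involutive_support A h).choose else id

lemma mover_involutive {X : Type*} [DecidableEq X] (A : Finset X) :
    Function.Involutive (mover A) := by
  rw [mover]
  split_ifs with h
  · exact (exists_involutive_support A h).choose_spec.1
  · exact fun _ => rfl

lemma mover_eq_self_iff {X : Type*} [DecidableEq X] {A : Finset X} (h : Even A.card) (x : X) :
    mover A x = x ↔ x ∉ A := by
  rw [mover, dif_pos h]
  exact (exists_involutive_support A h).choose_spec.2 x

/-- The weight of `u`, `v` on the pairs of a set and an involution that share exactly one element,
that is, one fixed point. -/
noncomputable def splitWeight {X : Type*} [Fintype X] [DecidableEq X] (u : Finset X → ℝ)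
    (v : (X → X) → ℝ) : ℝ :=
  𝔼 e, 𝔼 A ∈ evenSets e, u (insert e A) * v (mover A)

lemma mul_splitProb_le {X : Type*} [Fintype X] [DecidableEq X] {θ : ℝ} (hθ : 0 ≤ θ)
    {u : Finset X → ℝ} {v : (X → X) → ℝ} (hu : ∀ A, 0 ≤ u A) (hv : ∀ s, 0 ≤ v s)
    {𝒢 : Finset (Finset X)} (h3 : ∀ H ∈ 𝒢, H.card = 3)
    (h𝒢 : ∀ H ∈ 𝒢, LocallyUniform θ u v H) :
    u Finset.univ * v id * 𝔼 e, splitProb 𝒢 e ≤ θ ^ 2 * splitWeight u v := by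
  simp only [splitProb, splitWeight, Finset.mul_expect]
  refine Finset.expect_le_expect fun e _ => Finset.expect_le_expect fun A hA => ?_
  obtain ⟨heA, heven⟩ := (Finset.mem_filter.1 hA).2
  have hrhs : 0 ≤ θ ^ 2 * (u (insert e A) * v (mover A)) :=
    mul_nonneg (sq_nonneg _) (mul_nonneg (hu _) (hv _))
  split_ifs with h
  · obtain ⟨⟨H, hH, hHsub⟩, ⟨H', hH', hHsub'⟩⟩ := h
    have h1 : u Finset.univ ≤ θ * u (insert e A) := by
      refine ((h𝒢 H hH).1 (insert e A \ H) Finset.disjoint_sdiff ?_ _ fun x => ?_).2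
      · rw [Finset.card_sdiff_of_subset hHsub, h3 H hH, Finset.card_insert_of_notMem heA]
        have := Finset.card_le_card hHsub
        rw [h3 H hH, Finset.card_insert_of_notMem heA] at this
        obtain ⟨k, hk⟩ := heven
        exact ⟨k - 1, by omega⟩
      · by_cases hx : x ∈ H
        · simp [hx, Finset.mem_insert.1 (hHsub hx)]
        · simp [hx]
    have h2 : v id ≤ θ * v (mover A) :=
      ((h𝒢 H' hH').2 _ (mover_involutive A) fun x hx =>
        (mover_eq_self_iff heven x).2 (Finset.mem_compl.1 (hHsub' hx))).2
    calc u Finset.univ * v id * 1 ≤ (θ * u (insert e A)) * (θ * v (mover A)) := by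
          rw [mul_one]
          exact mul_le_mul h1 h2 (hv _) (mul_nonneg hθ (hu _))
      _ = _ := by ring
  · simpa using hrhs

open Classical in
/-- The local inequality: the weight on triples around which `u`, `v` are uniform is bounded by the
weight on pairs that share one element and a small multiple of the weight on the full core. -/
lemma exists_local_bound {γ : ℝ} (hγ : 0 < γ) (hγ1 : γ < 1) :
    ∃ C : ℝ, 0 < C ∧ ∀ (m : ℕ) (θ : ℝ) (u : Finset (Core m) → ℝ) (v : (Core m → Core m) → ℝ),
      0 ≤ θ → (∀ A, 0 ≤ u A) → (∀ s, 0 ≤ v s) →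
      𝔼 κ : Equiv.Perm (Core m),
        (if LocallyUniform θ (twistSet κ u) (twistMap κ v) (coreTriple m)
          then coreWeight (twistSet κ u) (twistMap κ v) else 0) ≤
        3 * θ ^ 4 / (1 - γ) * splitWeight u v +
          θ ^ 2 * C / (3 + 2 * m) ^ 2 * (u Finset.univ * v id) := by
  obtain ⟨C, hC, hdens⟩ := exists_triple_density_le hγ hγ1
  refine ⟨C, hC, fun m θ u v hθ hu hv => ?_⟩
  set 𝒢 : Finset (Finset (Core m)) :=
    Finset.univ.filter fun H => H.card = 3 ∧ LocallyUniform θ u v H with h𝒢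
  have h3 : ∀ H ∈ 𝒢, H.card = 3 := fun H hH => (Finset.mem_filter.1 hH).2.1
  have hunif : ∀ H ∈ 𝒢, LocallyUniform θ u v H := fun H hH => (Finset.mem_filter.1 hH).2.2
  have huv : 0 ≤ u Finset.univ * v id := mul_nonneg (hu _) (hv _)
  have hpt : ∀ κ : Equiv.Perm (Core m),
      (if LocallyUniform θ (twistSet κ u) (twistMap κ v) (coreTriple m)
        then coreWeight (twistSet κ u) (twistMap κ v) else 0) ≤
      θ ^ 2 * (u Finset.univ * v id) *
        (if (coreTriple m).map κ.toEmbedding ∈ 𝒢 then (1 : ℝ) else 0) := by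
    intro κ
    split_ifs with h1 h2 h2
    · have ha : twistSet κ u (coreTriple m) ≤ θ * u Finset.univ := by
        have := (h1.1 ∅ (by simp) (by simp) (coreTriple m) (by simp)).1
        simpa [twistSet] using this
      have hb : 𝔼 b : BlockInv m, twistMap κ v (Sum.map id b.1) ≤ θ * v id := by
        refine Finset.expect_le Finset.univ_nonempty fun b _ => ?_
        have := (h1.2 (Sum.map id b.1) (Sum.rec (fun _ => rfl) fun x => by simp [b.2 x])
          (fun x hx => by
            obtain ⟨y, -, rfl⟩ := Finset.mem_map.1 hx
            simp)).1
        have hid : κ ∘ id ∘ κ.symm = id := by funext x; simp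
        simpa only [twistMap, hid] using this
      calc coreWeight (twistSet κ u) (twistMap κ v) ≤ (θ * u Finset.univ) * (θ * v id) :=
            mul_le_mul ha hb (Finset.expect_nonneg fun _ _ => hv _) (mul_nonneg hθ (hu _))
        _ = _ := by ring
    · exact absurd (Finset.mem_filter.2 ⟨Finset.mem_univ _, by
        rw [Finset.card_map, card_coreTriple], h1.of_twist⟩) h2
    · have := sq_nonneg θ
      positivity
    · simp
  have hcard : (Fintype.card (Core m) : ℝ) = 3 + 2 * m := by
    simp [Block]; ring
  have h1γ : 0 < 1 - γ := by linarith
  calc _ ≤ _ := Finset.expect_le_expect fun κ _ => hpt κ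
    _ = θ ^ 2 * (u Finset.univ * v id) * 𝔼 κ : Equiv.Perm (Core m),
        (if (coreTriple m).map κ.toEmbedding ∈ 𝒢 then (1 : ℝ) else 0) := by
        rw [Finset.mul_expect]
    _ ≤ θ ^ 2 * (u Finset.univ * v id) *
        (3 / (1 - γ) * 𝔼 e, splitProb 𝒢 e + C / (Fintype.card (Core m) : ℝ) ^ 2) :=
        mul_le_mul_of_nonneg_left (hdens _ _ 𝒢 card_coreTriple h3)
          (mul_nonneg (sq_nonneg _) huv)
    _ = 3 * θ ^ 2 / (1 - γ) * (u Finset.univ * v id * 𝔼 e, splitProb 𝒢 e) +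
        θ ^ 2 * C / (3 + 2 * m) ^ 2 * (u Finset.univ * v id) := by
        rw [hcard]; ring
    _ ≤ 3 * θ ^ 2 / (1 - γ) * (θ ^ 2 * splitWeight u v) +
        θ ^ 2 * C / (3 + 2 * m) ^ 2 * (u Finset.univ * v id) := by
        refine add_le_add_left (mul_le_mul_of_nonneg_left
          (mul_splitProb_le hθ hu hv h3 hunif) (by positivity)) _
    _ = _ := by ring

end Local

section Global

/-- The ground set: three common elements and `N` blocks. -/
abbrev Ground (N m : ℕ) : Type := Fin 3 ⊕ (Fin N × Block m)

variable {N m : ℕ}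

/-- The inclusion of the core with the `i`-th block. -/
def coreIncl (i : Fin N) : Core m → Ground N m := Sum.map id (Prod.mk i)

/-- The set that is `A` on the `i`-th core and `T` on the other blocks. -/
def glueSet (i : Fin N) (A : Finset (Core m)) (T : Fin N → Block m → Bool) : Ground N m → Bool :=
  Sum.elim (fun x => decide (Sum.inl x ∈ A))
    (fun jq => if jq.1 = i then decide (Sum.inr jq.2 ∈ A) else T jq.1 jq.2)

/-- The map that is `s` on the `i`-th core and `S` on the other blocks. -/
def glueMap (i : Fin N) (s : Core m → Core m) (S : Fin N → Block m → Block m) :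
    Ground N m → Ground N m :=
  Sum.elim (fun x => coreIncl i (s (Sum.inl x)))
    (fun jq => if jq.1 = i then coreIncl i (s (Sum.inr jq.2)) else Sum.inr (jq.1, S jq.1 jq.2))

lemma glueMap_coreIncl (i : Fin N) (s : Core m → Core m) (S : Fin N → Block m → Block m)
    (x : Core m) : glueMap i s S (coreIncl i x) = coreIncl i (s x) := by
  rcases x with x | x <;> simp [glueMap, coreIncl]

lemma glueSet_coreIncl (i : Fin N) (A : Finset (Core m)) (T : Fin N → Block m → Bool)
    (x : Core m) : glueSet i A T (coreIncl i x) = decide (x ∈ A) := by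
  rcases x with x | x <;> simp [glueSet, coreIncl]

lemma glueMap_inr_of_ne {i j : Fin N} (h : j ≠ i) (s : Core m → Core m)
    (S : Fin N → Block m → Block m) (q : Block m) :
    glueMap i s S (Sum.inr (j, q)) = Sum.inr (j, S j q) := by
  simp [glueMap, h]

lemma glueSet_inr_of_ne {i j : Fin N} (h : j ≠ i) (A : Finset (Core m))
    (T : Fin N → Block m → Bool) (q : Block m) : glueSet i A T (Sum.inr (j, q)) = T j q := by
  simp [glueSet, h]

/-- Every element of the ground set is in the `i`-th core or in another block. -/
@[elab_as_elim]
lemma ground_cases (i : Fin N) {p : Ground N m → Prop} (hcore : ∀ x, p (coreIncl i x))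
    (hother : ∀ j q, j ≠ i → p (Sum.inr (j, q))) (x : Ground N m) : p x := by
  rcases x with x | ⟨j, q⟩
  · exact hcore (Sum.inl x)
  · by_cases h : j = i
    · subst h; exact hcore (Sum.inr q)
    · exact hother j q h

lemma glueMap_comp (i : Fin N) (s s' : Core m → Core m) (S S' : Fin N → Block m → Block m) :
    glueMap i s S ∘ glueMap i s' S' = glueMap i (s ∘ s') fun j => S j ∘ S' j := by
  funext x
  induction x using ground_cases i with
  | hcore x =>
    simp [glueMap_coreIncl]
  | hother j q h =>
    simp [glueMap_inr_of_ne h]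

lemma glueMap_id (i : Fin N) : glueMap i (id : Core m → Core m) (fun _ => id) = id := by
  funext x
  induction x using ground_cases i with
  | hcore x =>
    simp [glueMap_coreIncl]
  | hother j q h =>
    simp [glueMap_inr_of_ne h]

/-- The permutation of the ground set that acts by `κ` on the `i`-th core. -/
def coreLift (i : Fin N) (κ : Equiv.Perm (Core m)) : Equiv.Perm (Ground N m) where
  toFun := glueMap i κ fun _ => id
  invFun := glueMap i κ.symm fun _ => id
  left_inv x := by
    have := congrFun (glueMap_comp i κ.symm κ (fun _ => id) (fun _ => (id : Block m → Block m))) x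
    simpa [glueMap_id] using this
  right_inv x := by
    have := congrFun (glueMap_comp i κ κ.symm (fun _ => id) (fun _ => (id : Block m → Block m))) x
    simpa [glueMap_id] using this

lemma coe_coreLift (i : Fin N) (κ : Equiv.Perm (Core m)) :
    (coreLift i κ : Ground N m → Ground N m) = glueMap i κ fun _ => id := rfl

lemma coe_coreLift_symm (i : Fin N) (κ : Equiv.Perm (Core m)) :
    ((coreLift i κ).symm : Ground N m → Ground N m) = glueMap i κ.symm fun _ => id := rfl

lemma glueSet_comp_coreLift_symm (i : Fin N) (A : Finset (Core m)) (T : Fin N → Block m → Bool)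
    (κ : Equiv.Perm (Core m)) :
    glueSet i A T ∘ (coreLift i κ).symm = glueSet i (A.map κ.toEmbedding) T := by
  rw [coe_coreLift_symm]
  funext x
  induction x using ground_cases i with
  | hcore x =>
    simp [glueMap_coreIncl, glueSet_coreIncl, Finset.mem_map_equiv]
  | hother j q h =>
    simp [glueMap_inr_of_ne h, glueSet_inr_of_ne h]

lemma coreLift_conj_glueMap (i : Fin N) (s : Core m → Core m) (S : Fin N → Block m → Block m)
    (κ : Equiv.Perm (Core m)) :
    coreLift i κ ∘ glueMap i s S ∘ (coreLift i κ).symm = glueMap i (κ ∘ s ∘ κ.symm) S := by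
  rw [coe_coreLift, coe_coreLift_symm, glueMap_comp, glueMap_comp]
  rfl

/-- The average of `f` over the sets that are `A` on the `i`-th core of the arrangement `ρ`. -/
noncomputable def setAvg (f : (Ground N m → Bool) → ℝ) (ρ : Equiv.Perm (Ground N m))
    (τ : Fin N → Bool) (i : Fin N) (A : Finset (Core m)) : ℝ :=
  𝔼 ω : Fin N → Fin m → Bool,
    f (glueSet i A (fun j q => fillWith (fun _ => false) τ ω j q.1) ∘ ρ.symm)

/-- The average of `g` over the maps that are `s` on the `i`-th core of the arrangement `ρ`. -/
noncomputable def mapAvg (g : (Ground N m → Ground N m) → ℝ) (ρ : Equiv.Perm (Ground N m))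
    (τ : Fin N → Bool) (i : Fin N) (s : Core m → Core m) : ℝ :=
  𝔼 ω : Fin N → BlockInv m,
    g (ρ ∘ glueMap i s (fun j => (fillWith (blockFlip m) (fun j => !τ j) ω j).1) ∘ ρ.symm)

lemma setAvg_nonneg {f : (Ground N m → Bool) → ℝ} (hf : ∀ U, 0 ≤ f U)
    (ρ : Equiv.Perm (Ground N m)) (τ : Fin N → Bool) (i : Fin N) (A : Finset (Core m)) :
    0 ≤ setAvg f ρ τ i A := Finset.expect_nonneg fun _ _ => hf _

lemma mapAvg_nonneg {g : (Ground N m → Ground N m) → ℝ} (hg : ∀ σ, 0 ≤ g σ)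
    (ρ : Equiv.Perm (Ground N m)) (τ : Fin N → Bool) (i : Fin N) (s : Core m → Core m) :
    0 ≤ mapAvg g ρ τ i s := Finset.expect_nonneg fun _ _ => hg _

lemma setAvg_mul_coreLift (f : (Ground N m → Bool) → ℝ) (ρ : Equiv.Perm (Ground N m))
    (τ : Fin N → Bool) (i : Fin N) (κ : Equiv.Perm (Core m)) :
    setAvg f (ρ * coreLift i κ) τ i = twistSet κ (setAvg f ρ τ i) := by
  funext A
  refine Finset.expect_congr rfl fun ω _ => congrArg f ?_
  rw [← glueSet_comp_coreLift_symm]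
  rfl

lemma mapAvg_mul_coreLift (g : (Ground N m → Ground N m) → ℝ) (ρ : Equiv.Perm (Ground N m))
    (τ : Fin N → Bool) (i : Fin N) (κ : Equiv.Perm (Core m)) :
    mapAvg g (ρ * coreLift i κ) τ i = twistMap κ (mapAvg g ρ τ i) := by
  funext s
  refine Finset.expect_congr rfl fun ω _ => congrArg g ?_
  rw [← coreLift_conj_glueMap]
  rfl

/-- The arranged set that contains the common elements and the pairs selected by `ω`. -/
def arrangedSet (ρ : Equiv.Perm (Ground N m)) (ω : Fin N → Fin m → Bool) : Ground N m → Bool :=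
  Sum.elim (fun _ => true) (fun jq => ω jq.1 jq.2.1) ∘ ρ.symm

/-- The arranged map that fixes the common elements and acts by `ω` on the blocks. -/
def arrangedMap (ρ : Equiv.Perm (Ground N m)) (ω : Fin N → BlockInv m) :
    Ground N m → Ground N m :=
  ρ ∘ Sum.map id (fun jq => (jq.1, (ω jq.1).1 jq.2)) ∘ ρ.symm

lemma marginal_arrangedSet (f : (Ground N m → Bool) → ℝ) (ρ : Equiv.Perm (Ground N m))
    (τ : Fin N → Bool) (i : Fin N) :
    marginal (fun _ => false) (fun ω => f (arrangedSet ρ ω)) τ i =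
      fun a => setAvg f ρ τ i (coreSet a) := by
  funext a
  refine Finset.expect_congr rfl fun ω _ => congrArg f ?_
  rw [arrangedSet]
  congr 1
  funext x
  rcases x with x | ⟨j, q⟩
  · simp [glueSet, coreSet]
  · by_cases h : j = i
    · subst h; simp [glueSet, coreSet]
    · simp [glueSet, h]

lemma marginal_arrangedMap (g : (Ground N m → Ground N m) → ℝ) (ρ : Equiv.Perm (Ground N m))
    (τ : Fin N → Bool) (i : Fin N) :
    marginal (blockFlip m) (fun ω => g (arrangedMap ρ ω)) (fun j => !τ j) i =
      fun b => mapAvg g ρ τ i (Sum.map id b.1) := by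
  funext b
  refine Finset.expect_congr rfl fun ω _ => congrArg g ?_
  rw [arrangedMap]
  congr 2
  funext x
  rcases x with x | ⟨j, q⟩
  · simp [glueMap, coreIncl]
  · by_cases h : j = i
    · subst h; simp [glueMap, coreIncl]
    · simp [glueMap, h]

lemma disjointWeight_arranged (f : (Ground N m → Bool) → ℝ) (g : (Ground N m → Ground N m) → ℝ)
    (ρ : Equiv.Perm (Ground N m)) (τ : Fin N → Bool) (i : Fin N) :
    disjointWeight (fun _ => false) (blockFlip m) (fun ω => f (arrangedSet ρ ω))
      (fun ω => g (arrangedMap ρ ω)) τ i = coreWeight (setAvg f ρ τ i) (mapAvg g ρ τ i) := by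
  simp only [disjointWeight, marginal_arrangedSet, marginal_arrangedMap, coreWeight, coreSet_false]

/-- The average over arrangements, types of the blocks, and the choice of a special block. -/
noncomputable def fullAvg (X : Equiv.Perm (Ground N m) → (Fin N → Bool) → Fin N → ℝ) : ℝ :=
  𝔼 ρ, 𝔼 τ, 𝔼 i, X ρ τ i

lemma fullAvg_mono {X Y : Equiv.Perm (Ground N m) → (Fin N → Bool) → Fin N → ℝ}
    (h : ∀ ρ τ i, X ρ τ i ≤ Y ρ τ i) : fullAvg X ≤ fullAvg Y :=
  Finset.expect_le_expect fun ρ _ => Finset.expect_le_expect fun τ _ =>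
    Finset.expect_le_expect fun i _ => h ρ τ i

lemma fullAvg_add (X Y : Equiv.Perm (Ground N m) → (Fin N → Bool) → Fin N → ℝ) :
    fullAvg (fun ρ τ i => X ρ τ i + Y ρ τ i) = fullAvg X + fullAvg Y := by
  simp only [fullAvg, Finset.expect_add_distrib]

lemma fullAvg_mul (c : ℝ) (X : Equiv.Perm (Ground N m) → (Fin N → Bool) → Fin N → ℝ) :
    fullAvg (fun ρ τ i => c * X ρ τ i) = c * fullAvg X := by
  simp only [fullAvg, Finset.mul_expect]

lemma fullAvg_sum {J : Type*} (s : Finset J)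
    (X : J → Equiv.Perm (Ground N m) → (Fin N → Bool) → Fin N → ℝ) :
    fullAvg (fun ρ τ i => ∑ j ∈ s, X j ρ τ i) = ∑ j ∈ s, fullAvg (X j) := by
  simp only [fullAvg, Finset.expect_sum_comm]

lemma fullAvg_const [NeZero N] (c : ℝ) :
    fullAvg (fun (_ : Equiv.Perm (Ground N m)) (_ : Fin N → Bool) (_ : Fin N) => c) = c := by
  simp only [fullAvg, Fintype.expect_const]

lemma expect_rotate {α β γ : Type*} [Fintype α] [Fintype β] [Fintype γ] (X : α → β → γ → ℝ) :
    𝔼 a, 𝔼 b, 𝔼 c, X a b c = 𝔼 b, 𝔼 c, 𝔼 a, X a b c := by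
  rw [Finset.expect_comm]
  refine Finset.expect_congr rfl fun b _ => ?_
  rw [Finset.expect_comm]

lemma fullAvg_expect {J : Type*} [Fintype J]
    (X : J → Equiv.Perm (Ground N m) → (Fin N → Bool) → Fin N → ℝ) :
    fullAvg (fun ρ τ i => 𝔼 j, X j ρ τ i) = 𝔼 j, fullAvg (X j) := by
  simp only [fullAvg]
  symm
  rw [Finset.expect_comm]
  exact Finset.expect_congr rfl fun ρ _ => expect_rotate fun j τ i => X j ρ τ i

lemma fullAvg_shift (X : Equiv.Perm (Ground N m) → (Fin N → Bool) → Fin N → ℝ)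
    (κ : Equiv.Perm (Core m)) :
    fullAvg (fun ρ τ i => X (ρ * coreLift i κ) τ i) = fullAvg X := by
  rw [fullAvg, fullAvg, expect_rotate, expect_rotate X]
  exact Finset.expect_congr rfl fun τ _ => Finset.expect_congr rfl fun i _ =>
    Fintype.expect_equiv (Equiv.mulRight (coreLift i κ)) _ _ fun ρ => rfl

lemma fullAvg_expect_shift (X : Equiv.Perm (Ground N m) → (Fin N → Bool) → Fin N → ℝ) :
    fullAvg (fun ρ τ i => 𝔼 κ : Equiv.Perm (Core m), X (ρ * coreLift i κ) τ i) = fullAvg X := by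
  rw [fullAvg_expect fun (κ : Equiv.Perm (Core m)) ρ τ i => X (ρ * coreLift i κ) τ i]
  simp only [fullAvg_shift, Fintype.expect_const]

open Classical in
/-- The main inequality for a pair of `[0,1]`-valued functions: the weight on the pairs of a set
and an involution that share three elements is bounded by the weights on the pairs that share one
element and a full core, up to an exponentially small error. -/
theorem exists_corruption_bound {γ : ℝ} (hγ : 0 < γ) (hγ1 : γ ≤ 1 / 2) :
    ∃ C : ℝ, 0 < C ∧ ∀ m : ℕ, ∃ δ D : ℝ, 0 < δ ∧ 0 < D ∧ ∀ (N : ℕ) [NeZero N]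
      (f : (Ground N m → Bool) → ℝ) (g : (Ground N m → Ground N m) → ℝ),
      (∀ U, 0 ≤ f U) → (∀ U, f U ≤ 1) → (∀ σ, 0 ≤ g σ) → (∀ σ, g σ ≤ 1) →
      (1 - γ) * fullAvg (fun ρ τ i => coreWeight (setAvg f ρ τ i) (mapAvg g ρ τ i)) ≤
        3 * ((1 + γ) / (1 - γ)) ^ 4 / (1 - γ) *
            fullAvg (fun ρ τ i => splitWeight (setAvg f ρ τ i) (mapAvg g ρ τ i)) +
          ((1 + γ) / (1 - γ)) ^ 2 * C / (3 + 2 * m) ^ 2 *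
            fullAvg (fun ρ τ i => setAvg f ρ τ i Finset.univ * mapAvg g ρ τ i id) +
          D * Real.exp (-δ * N) := by
  obtain ⟨C, hC, hlocal⟩ := exists_local_bound hγ (by linarith)
  refine ⟨C, hC, fun m => ?_⟩
  set K : ℝ := (Fintype.card (Equiv.Perm (Block m)) : ℝ) with hK
  have hK0 : 0 < K := by rw [hK]; exact_mod_cast Fintype.card_pos
  obtain ⟨δ, D, hδ, hD, hsum⟩ := exists_expect_biased_disjointWeight_le
    (fun _ : Fin m => false) (blockFlip m) hγ hγ1 (div_pos hγ hK0)
  refine ⟨δ, K * D, hδ, by positivity, fun N _ f g hf0 hf1 hg0 hg1 => ?_⟩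
  set θ := (1 + γ) / (1 - γ) with hθ
  have hθ0 : 0 ≤ θ := div_nonneg (by linarith) (by linarith)
  have hu : ∀ ρ τ i A, 0 ≤ setAvg f ρ τ i A := setAvg_nonneg hf0
  have hv : ∀ ρ τ i s, 0 ≤ mapAvg g ρ τ i s := mapAvg_nonneg hg0
  set W : Equiv.Perm (Ground N m) → (Fin N → Bool) → Fin N → ℝ :=
    fun ρ τ i => coreWeight (setAvg f ρ τ i) (mapAvg g ρ τ i) with hW
  have hW0 : ∀ ρ τ i, 0 ≤ W ρ τ i := fun ρ τ i =>
    mul_nonneg (hu _ _ _ _) (Finset.expect_nonneg fun _ _ => hv _ _ _ _)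
  have hbiased : fullAvg (fun ρ τ i =>
      if LocallyBiased γ (setAvg f ρ τ i) (mapAvg g ρ τ i) then W ρ τ i else 0) ≤
      γ / K * fullAvg W + D * Real.exp (-δ * N) := by
    have h := hsum (Fin N) (Equiv.Perm (Ground N m)) (fun ρ ω => f (arrangedSet ρ ω))
      (fun ρ ω => g (arrangedMap ρ ω)) (fun _ _ => hf0 _) (fun _ _ => hf1 _) (fun _ _ => hg0 _)
      (fun _ _ => hg1 _)
    simp only [marginal_arrangedSet, marginal_arrangedMap, disjointWeight_arranged,
      Fintype.card_fin] at h
    simp only [fullAvg, LocallyBiased, hW]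
    convert h
  have hnonuniform : fullAvg (fun ρ τ i =>
      if LocallyUniform θ (setAvg f ρ τ i) (mapAvg g ρ τ i) (coreTriple m) then 0 else W ρ τ i) ≤
      K * fullAvg (fun ρ τ i =>
        if LocallyBiased γ (setAvg f ρ τ i) (mapAvg g ρ τ i) then W ρ τ i else 0) := by
    set Y : Equiv.Perm (Ground N m) → (Fin N → Bool) → Fin N → ℝ := fun ρ τ i =>
      if LocallyBiased γ (setAvg f ρ τ i) (mapAvg g ρ τ i) then W ρ τ i else 0 with hY
    have hY0 : ∀ ρ τ i, 0 ≤ Y ρ τ i := fun ρ τ i => by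
      simp only [hY]; split_ifs; exacts [hW0 _ _ _, le_rfl]
    calc _ ≤ fullAvg (fun ρ τ i =>
          ∑ π : Equiv.Perm (Block m), Y (ρ * coreLift i (corePerm π)) τ i) := by
          refine fullAvg_mono fun ρ τ i => ?_
          split_ifs with h
          · exact Finset.sum_nonneg fun _ _ => hY0 _ _ _
          · obtain ⟨π, hπ⟩ := exists_locallyBiased hγ (by linarith) h
            refine le_trans (le_of_eq ?_) (Finset.single_le_sum (fun π _ => hY0 _ _ _)
              (Finset.mem_univ π))
            simp only [hY, hW, setAvg_mul_coreLift, mapAvg_mul_coreLift, if_pos hπ,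
              coreWeight_twist]
      _ = K * fullAvg Y := by
          rw [fullAvg_sum]
          simp only [fullAvg_shift Y, Finset.sum_const, nsmul_eq_mul, Finset.card_univ, hK]
  have huniform : fullAvg (fun ρ τ i =>
      if LocallyUniform θ (setAvg f ρ τ i) (mapAvg g ρ τ i) (coreTriple m) then W ρ τ i else 0) ≤
      3 * θ ^ 4 / (1 - γ) *
            fullAvg (fun ρ τ i => splitWeight (setAvg f ρ τ i) (mapAvg g ρ τ i)) +
          θ ^ 2 * C / (3 + 2 * m) ^ 2 *
            fullAvg (fun ρ τ i => setAvg f ρ τ i Finset.univ * mapAvg g ρ τ i id) := by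
    rw [← fullAvg_expect_shift, ← fullAvg_mul, ← fullAvg_mul, ← fullAvg_add]
    refine fullAvg_mono fun ρ τ i => ?_
    simp only [hW, setAvg_mul_coreLift, mapAvg_mul_coreLift]
    exact hlocal m θ _ _ hθ0 (hu ρ τ i) (hv ρ τ i)
  have hsplit : fullAvg W = fullAvg (fun ρ τ i =>
      if LocallyUniform θ (setAvg f ρ τ i) (mapAvg g ρ τ i) (coreTriple m) then W ρ τ i else 0) +
      fullAvg (fun ρ τ i =>
      if LocallyUniform θ (setAvg f ρ τ i) (mapAvg g ρ τ i) (coreTriple m) then 0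
        else W ρ τ i) := by
    rw [← fullAvg_add]
    congr 1
    funext ρ τ i
    split_ifs <;> simp
  have hKb := mul_le_mul_of_nonneg_left hbiased hK0.le
  have hKγ : K * (γ / K * fullAvg W + D * Real.exp (-δ * N)) =
      γ * fullAvg W + K * D * Real.exp (-δ * N) := by
    field_simp
  rw [hKγ] at hKb
  linarith

/-- The number of fixed points of `σ` in the set `U`. -/
def fixedCount {X : Type*} [Fintype X] [DecidableEq X] (U : X → Bool) (σ : X → X) : ℕ :=
  (Finset.univ.filter fun x => U x = true ∧ σ x = x).card

lemma fixedCount_conj {X : Type*} [Fintype X] [DecidableEq X] (ρ : Equiv.Perm X) (U : X → Bool)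
    (σ : X → X) : fixedCount (U ∘ ρ.symm) (ρ ∘ σ ∘ ρ.symm) = fixedCount U σ := by
  rw [fixedCount, fixedCount]
  refine Eq.trans ?_ (Finset.card_map ρ.toEmbedding)
  congr 1
  ext x
  simp [Finset.mem_map_equiv, ← Equiv.eq_symm_apply]

/-- A pair of compatible choices on the other blocks leaves the number of common elements
unchanged. -/
lemma glue_compatible (i : Fin N) {A : Finset (Core m)} {s : Core m → Core m}
    (hs : Function.Involutive s) (hA : ∀ x, s x ∈ A ↔ x ∈ A) (τ : Fin N → Bool)
    (ω : Fin N → Fin m → Bool) (ω' : Fin N → BlockInv m) :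
    let U := glueSet i A fun j q => fillWith (fun _ => false) τ ω j q.1
    let σ := glueMap i s fun j => (fillWith (blockFlip m) (fun j => !τ j) ω' j).1
    Function.Involutive σ ∧ (∀ x, U (σ x) = U x) ∧
      fixedCount U σ = (A.filter fun x => s x = x).card := by
  intro U σ
  refine ⟨fun x => ?_, fun x => ?_, ?_⟩
  · induction x using ground_cases i with
    | hcore x =>
      simp [σ, glueMap_coreIncl, hs x]
    | hother j q h =>
      simp only [σ, glueMap_inr_of_ne h]
      rw [(fillWith (blockFlip m) (fun j => !τ j) ω' j).2 q]
  · induction x using ground_cases i with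
    | hcore x =>
      simp [σ, U, glueMap_coreIncl, glueSet_coreIncl, hA x]
    | hother j q h =>
      simp only [σ, U, glueMap_inr_of_ne h, glueSet_inr_of_ne h]
      cases hτ : τ j <;> simp [fillWith, hτ, blockFlip]
  · have hinj : Function.Injective (coreIncl i : Core m → Ground N m) :=
      Sum.map_injective.2 ⟨Function.injective_id, Prod.mk_right_injective i⟩
    rw [fixedCount, ← Finset.card_map ⟨_, hinj⟩]
    congr 1
    ext x
    rw [Finset.mem_filter]
    induction x using ground_cases i with
    | hcore x =>
      simp [σ, U, glueMap_coreIncl, glueSet_coreIncl, hinj.eq_iff]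
    | hother j q h =>
      have h1 : ¬ (U (Sum.inr (j, q)) = true ∧ σ (Sum.inr (j, q)) = Sum.inr (j, q)) := by
        simp only [σ, U, glueMap_inr_of_ne h, glueSet_inr_of_ne h]
        cases hτ : τ j <;> simp [fillWith, hτ, blockFlip, Prod.ext_iff]
      have h2 : Sum.inr (j, q) ∉ (A.filter fun x => s x = x).map ⟨coreIncl i, hinj⟩ := by
        intro hmem
        obtain ⟨y, -, hy⟩ := Finset.mem_map.1 hmem
        rcases y with y | y
        · simp [coreIncl] at hy
        · simp [coreIncl] at hy
          exact h hy.1.symm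
      simp [h1, h2]

/-- A family of products that sums to a function of the number of common elements also does so
after averaging. -/
lemma sum_setAvg_mul_mapAvg {J : Type*} [Fintype J] (w : J → ℝ)
    (f : J → (Ground N m → Bool) → ℝ) (g : J → (Ground N m → Ground N m) → ℝ) (Λ : ℕ → ℝ)
    (hΛ : ∀ U σ, Function.Involutive σ → (∀ x, U (σ x) = U x) → Odd (fixedCount U σ) →
      ∑ j, w j * (f j U * g j σ) = Λ (fixedCount U σ))
    (ρ : Equiv.Perm (Ground N m)) (τ : Fin N → Bool) (i : Fin N) {A : Finset (Core m)}
    {s : Core m → Core m} (hs : Function.Involutive s) (hA : ∀ x, s x ∈ A ↔ x ∈ A)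
    (hodd : Odd (A.filter fun x => s x = x).card) :
    ∑ j, w j * (setAvg (f j) ρ τ i A * mapAvg (g j) ρ τ i s) =
      Λ (A.filter fun x => s x = x).card := by
  have hpt : ∀ (ω : Fin N → Fin m → Bool) (ω' : Fin N → BlockInv m), ∑ j, w j *
      (f j (glueSet i A (fun j q => fillWith (fun _ => false) τ ω j q.1) ∘ ρ.symm) *
      g j (ρ ∘ glueMap i s (fun j => (fillWith (blockFlip m) (fun j => !τ j) ω' j).1) ∘ ρ.symm)) =
      Λ (A.filter fun x => s x = x).card := by
    intro ω ω'
    obtain ⟨h1, h2, h3⟩ := glue_compatible i hs hA τ ω ω'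
    rw [← h3] at hodd ⊢
    rw [← fixedCount_conj ρ] at hodd ⊢
    refine hΛ _ _ (fun x => ?_) (fun x => ?_) hodd
    · simp [h1 (ρ.symm x)]
    · simp [h2 (ρ.symm x)]
  have hexpand : ∀ j, w j * (setAvg (f j) ρ τ i A * mapAvg (g j) ρ τ i s) =
      𝔼 ω : Fin N → Fin m → Bool, 𝔼 ω' : Fin N → BlockInv m, w j *
      (f j (glueSet i A (fun j q => fillWith (fun _ => false) τ ω j q.1) ∘ ρ.symm) *
      g j (ρ ∘ glueMap i s (fun j => (fillWith (blockFlip m) (fun j => !τ j) ω' j).1) ∘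
        ρ.symm)) := by
    intro j
    rw [setAvg, mapAvg, Finset.expect_mul, Finset.mul_expect]
    refine Finset.expect_congr rfl fun ω _ => ?_
    rw [Finset.mul_expect, Finset.mul_expect]
  simp only [hexpand, ← Finset.expect_sum_comm, hpt, Fintype.expect_const]

end Global

lemma mover_mem_iff {X : Type*} [DecidableEq X] {A : Finset X} (h : Even A.card) (x : X) :
    mover A x ∈ A ↔ x ∈ A := by
  have h1 := mover_eq_self_iff h x
  have h2 := mover_eq_self_iff h (mover A x)
  rw [mover_involutive A x] at h2
  rw [eq_comm] at h2
  exact not_iff_not.1 (h2.symm.trans h1)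

lemma mover_mem_insert_iff {X : Type*} [DecidableEq X] {A : Finset X} (h : Even A.card)
    (e x : X) : mover A x ∈ insert e A ↔ x ∈ insert e A := by
  by_cases hx : x ∈ A
  · simp [hx, (mover_mem_iff h x).2 hx]
  · rw [(mover_eq_self_iff h x).2 hx]

lemma filter_mover_insert {X : Type*} [DecidableEq X] {A : Finset X} (h : Even A.card) {e : X}
    (he : e ∉ A) : ((insert e A).filter fun x => mover A x = x) = {e} := by
  ext x
  rw [Finset.mem_filter, mover_eq_self_iff h, Finset.mem_insert, Finset.mem_singleton]
  constructor
  · rintro ⟨h1 | h1, h2⟩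
    · exact h1
    · exact absurd h1 h2
  · rintro rfl
    exact ⟨Or.inl rfl, he⟩

section Evaluation

variable {N m : ℕ} [NeZero N] {J : Type*} [Fintype J] {w : J → ℝ}
  {f : J → (Ground N m → Bool) → ℝ} {g : J → (Ground N m → Ground N m) → ℝ} {Λ : ℕ → ℝ}

lemma sum_fullAvg_coreWeight
    (hΛ : ∀ U σ, Function.Involutive σ → (∀ x, U (σ x) = U x) → Odd (fixedCount U σ) →
      ∑ j, w j * (f j U * g j σ) = Λ (fixedCount U σ)) :
    ∑ j, w j * fullAvg (fun ρ τ i => coreWeight (setAvg (f j) ρ τ i) (mapAvg (g j) ρ τ i)) =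
      Λ 3 := by
  simp only [← fullAvg_mul, ← fullAvg_sum]
  rw [← fullAvg_const (N := N) (m := m) (Λ 3)]
  congr 1
  funext ρ τ i
  have hexpand : ∀ j, w j * coreWeight (setAvg (f j) ρ τ i) (mapAvg (g j) ρ τ i) =
      𝔼 b : BlockInv m, w j *
        (setAvg (f j) ρ τ i (coreTriple m) * mapAvg (g j) ρ τ i (Sum.map id b.1)) := fun j => by
    rw [coreWeight, Finset.mul_expect, Finset.mul_expect]
  have hfilter : ∀ b : BlockInv m,
      ((coreTriple m).filter fun x => Sum.map id b.1 x = x) = coreTriple m := fun b => by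
    refine Finset.filter_true_of_mem fun x hx => ?_
    obtain ⟨y, -, rfl⟩ := Finset.mem_map.1 hx
    rfl
  have hpt : ∀ b : BlockInv m, ∑ j, w j *
      (setAvg (f j) ρ τ i (coreTriple m) * mapAvg (g j) ρ τ i (Sum.map id b.1)) = Λ 3 := by
    intro b
    rw [sum_setAvg_mul_mapAvg w f g Λ hΛ ρ τ i (A := coreTriple m) (s := Sum.map id b.1)
      (Sum.rec (fun _ => rfl) fun x => by simp [b.2 x])
      (Sum.rec (fun _ => Iff.rfl) fun x => by simp [coreTriple])
      (by rw [hfilter, card_coreTriple]; decide), hfilter, card_coreTriple]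
  simp only [hexpand, ← Finset.expect_sum_comm, hpt, Fintype.expect_const]

lemma sum_fullAvg_splitWeight
    (hΛ : ∀ U σ, Function.Involutive σ → (∀ x, U (σ x) = U x) → Odd (fixedCount U σ) →
      ∑ j, w j * (f j U * g j σ) = Λ (fixedCount U σ)) :
    ∑ j, w j * fullAvg (fun ρ τ i => splitWeight (setAvg (f j) ρ τ i) (mapAvg (g j) ρ τ i)) =
      Λ 1 := by
  simp only [← fullAvg_mul, ← fullAvg_sum]
  rw [← fullAvg_const (N := N) (m := m) (Λ 1)]
  congr 1
  funext ρ τ i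
  simp only [splitWeight, Finset.mul_expect, ← Finset.expect_sum_comm]
  have hpt : ∀ e, 𝔼 A ∈ evenSets e, ∑ j, w j *
      (setAvg (f j) ρ τ i (insert e A) * mapAvg (g j) ρ τ i (mover A)) = Λ 1 := by
    intro e
    rw [← Finset.expect_const (evenSets_nonempty e) (Λ 1)]
    refine Finset.expect_congr rfl fun A hA => ?_
    obtain ⟨heA, heven⟩ := (Finset.mem_filter.1 hA).2
    rw [sum_setAvg_mul_mapAvg w f g Λ hΛ ρ τ i (mover_involutive A)
      (mover_mem_insert_iff heven e) (by rw [filter_mover_insert heven heA]; simp),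
      filter_mover_insert heven heA, Finset.card_singleton]
  simp only [hpt, Fintype.expect_const]

lemma sum_fullAvg_full
    (hΛ : ∀ U σ, Function.Involutive σ → (∀ x, U (σ x) = U x) → Odd (fixedCount U σ) →
      ∑ j, w j * (f j U * g j σ) = Λ (fixedCount U σ)) :
    ∑ j, w j * fullAvg (fun ρ τ i => setAvg (f j) ρ τ i Finset.univ * mapAvg (g j) ρ τ i id) =
      Λ (3 + 2 * m) := by
  simp only [← fullAvg_mul, ← fullAvg_sum]
  rw [← fullAvg_const (N := N) (m := m) (Λ (3 + 2 * m))]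
  congr 1
  funext ρ τ i
  have hcard : ((Finset.univ : Finset (Core m)).filter fun x => id x = x).card = 3 + 2 * m := by
    simp [mul_comm]
  rw [sum_setAvg_mul_mapAvg w f g Λ hΛ ρ τ i (A := Finset.univ) (s := id) (fun _ => rfl)
    (fun _ => by simp) (by rw [hcard]; exact ⟨m + 1, by ring⟩), hcard]

end Evaluation

lemma exists_small_parameter {ε : ℝ} (hε : ε < 1) :
    ∃ γ : ℝ, 0 < γ ∧ γ ≤ 1 / 2 ∧
      1 - ε < (1 - γ) * (2 + ε) - 3 * ((1 + γ) / (1 - γ)) ^ 4 / (1 - γ) * ε := by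
  have hcont : ContinuousAt
      (fun γ : ℝ => (1 - γ) * (2 + ε) - 3 * ((1 + γ) / (1 - γ)) ^ 4 / (1 - γ) * ε) 0 := by
    have h1 : ContinuousAt (fun γ : ℝ => 1 - γ) 0 := by fun_prop
    have h2 : ContinuousAt (fun γ : ℝ => 1 + γ) 0 := by fun_prop
    have h0 : (1 : ℝ) - 0 ≠ 0 := by norm_num
    exact (h1.mul continuousAt_const).sub
      (((continuousAt_const.mul ((h2.div h1 h0).pow 4)).div h1 h0).mul continuousAt_const)
  have hev := hcont.eventually (lt_mem_nhds (show 1 - ε < _ by norm_num; linarith))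
  obtain ⟨r, hr, hball⟩ := Metric.eventually_nhds_iff.1 hev
  refine ⟨min (r / 2) (1 / 2), by positivity, min_le_right _ _, hball ?_⟩
  rw [Real.dist_eq, sub_zero, abs_of_pos (by positivity)]
  exact (min_le_left _ _).trans_lt (by linarith)

/-- A family of products of `[0,1]`-valued functions with bounded weights whose sum is the function
`(t - 1 + ε) / 2` of the number `t` of common elements is exponentially large. -/
theorem exists_rank_bound {ε : ℝ} (hε : 0 < ε) (hε1 : ε < 1) :
    ∃ (m : ℕ) (δ c : ℝ), 0 < m ∧ 0 < δ ∧ 0 < c ∧ ∀ (N : ℕ) [NeZero N] (J : Type) [Fintype J] (w : J → ℝ)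
      (f : J → (Ground N m → Bool) → ℝ) (g : J → (Ground N m → Ground N m) → ℝ) (B : ℝ),
      (∀ j, 0 ≤ w j) → (∀ j, w j ≤ B) →
      (∀ j U, 0 ≤ f j U) → (∀ j U, f j U ≤ 1) → (∀ j σ, 0 ≤ g j σ) → (∀ j σ, g j σ ≤ 1) →
      (∀ U σ, Function.Involutive σ → (∀ x, U (σ x) = U x) → Odd (fixedCount U σ) →
        ∑ j, w j * (f j U * g j σ) = ((fixedCount U σ : ℝ) - 1 + ε) / 2) →
      c * Real.exp (δ * N) ≤ Fintype.card J * B := by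
  obtain ⟨γ, hγ, hγ1, hgap⟩ := exists_small_parameter hε1
  obtain ⟨C, hC, hmain⟩ := exists_corruption_bound hγ hγ1
  set θ := (1 + γ) / (1 - γ) with hθ
  have hθ0 : 0 < θ := div_pos (by linarith) (by linarith)
  obtain ⟨m, hm⟩ := exists_nat_gt (2 * (θ ^ 2 * C) / (1 - ε))
  obtain ⟨δ, D, hδ, hD, hmain⟩ := hmain m
  have hm0 : 0 < m := by
    have h : 0 < 2 * (θ ^ 2 * C) / (1 - ε) := div_pos (by positivity) (by linarith)
    exact_mod_cast h.trans hm
  refine ⟨m, δ, (1 - ε) / (4 * D), hm0, hδ, div_pos (by linarith) (by linarith), ?_⟩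
  intro N _ J _ w f g B hw0 hwB hf0 hf1 hg0 hg1 hΛ
  have h3 := sum_fullAvg_coreWeight (Λ := fun t => ((t : ℝ) - 1 + ε) / 2) hΛ
  have h1 := sum_fullAvg_splitWeight (Λ := fun t => ((t : ℝ) - 1 + ε) / 2) hΛ
  have hk := sum_fullAvg_full (Λ := fun t => ((t : ℝ) - 1 + ε) / 2) hΛ
  have hsum := Finset.sum_le_sum fun j (_ : j ∈ Finset.univ) =>
    mul_le_mul_of_nonneg_left (hmain N (f j) (g j) (hf0 j) (hf1 j) (hg0 j) (hg1 j)) (hw0 j)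
  simp only [mul_add, mul_left_comm (w _), Finset.sum_add_distrib, ← Finset.mul_sum, h3, h1,
    hk] at hsum
  have hW : ∑ j, w j ≤ Fintype.card J * B := by
    have := Finset.sum_le_card_nsmul Finset.univ w B fun j _ => hwB j
    simpa using this
  set E := Real.exp (-δ * N) with hE
  have hE0 : 0 < E := Real.exp_pos _
  have hEE : Real.exp (δ * N) * E = 1 := by
    rw [hE, ← Real.exp_add]; simp
  have hsmall : θ ^ 2 * C / (3 + 2 * (m : ℝ)) ^ 2 * ((3 + 2 * (m : ℝ) - 1 + ε) / 2) ≤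
      (1 - ε) / 4 := by
    have hm0 : (0 : ℝ) ≤ m := Nat.cast_nonneg m
    rw [div_lt_iff₀ (by linarith)] at hm
    have hθC : 0 < θ ^ 2 * C := by positivity
    rw [div_mul_eq_mul_div, div_le_iff₀ (by positivity)]
    nlinarith
  push_cast at hsum
  have hlow : (1 - ε) / 4 ≤ Fintype.card J * B * D * E := by
    have : (∑ j, w j) * (D * E) ≤ Fintype.card J * B * (D * E) :=
      mul_le_mul_of_nonneg_right hW (by positivity)
    simp only [← Finset.sum_mul] at hsum
    linarith
  rw [div_mul_eq_mul_div, div_le_iff₀ (by positivity)]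
  have := mul_le_mul_of_nonneg_right hlow (Real.exp_pos (δ * N)).le
  calc (1 - ε) * Real.exp (δ * N) = 4 * ((1 - ε) / 4 * Real.exp (δ * N)) := by ring
    _ ≤ 4 * (Fintype.card J * B * D * E * Real.exp (δ * N)) := by linarith
    _ = Fintype.card J * B * (4 * D) * (Real.exp (δ * N) * E) := by ring
    _ = _ := by rw [hEE, mul_one]

/-- **Farkas' lemma** for finitely many linear functionals. -/
theorem exists_nonneg_combination {E : Type*} [AddCommGroup E] [Module ℝ E] (k : ℕ)
    (a : Fin k → E →ₗ[ℝ] ℝ) (c : E →ₗ[ℝ] ℝ) (h : ∀ x, (∀ i, 0 ≤ a i x) → 0 ≤ c x) :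
    ∃ l : Fin k → ℝ, (∀ i, 0 ≤ l i) ∧ c = ∑ i, l i • a i := by
  induction k generalizing c with
  | zero =>
    refine ⟨0, fun i => i.elim0, ?_⟩
    ext x
    have h1 := h x fun i => i.elim0
    have h2 := h (-x) fun i => i.elim0
    rw [map_neg] at h2
    simp
    linarith
  | succ k ih =>
    by_cases hrest : ∀ x, (∀ i : Fin k, 0 ≤ a i.succ x) → 0 ≤ c x
    · obtain ⟨l, hl, hc⟩ := ih (fun i => a i.succ) c hrest
      refine ⟨Fin.cons 0 l, fun i => Fin.cases le_rfl hl i, ?_⟩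
      rw [Fin.sum_univ_succ]
      simpa using hc
    · push Not at hrest
      obtain ⟨x₀, hx₀, hcx₀⟩ := hrest
      have ha0 : a 0 x₀ < 0 := by
        by_contra hle
        exact absurd (h x₀ fun i => Fin.cases (not_lt.1 hle) hx₀ i) (not_le.2 hcx₀)
      set t : ℝ := -(a 0 x₀)⁻¹ with ht
      have ht0 : 0 < t := neg_pos.2 (inv_lt_zero.2 ha0)
      have hta : t * a 0 x₀ = -1 := by rw [ht, neg_mul, inv_mul_cancel₀ ha0.ne]
      obtain ⟨l, hl, hc⟩ := ih (fun i => a i.succ + (t * a i.succ x₀) • a 0)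
        (c + (t * c x₀) • a 0) fun x hx => by
          have key := h (x + (t * a 0 x) • x₀) fun i => by
            refine Fin.cases ?_ (fun i => ?_) i
            · simp only [map_add, map_smul, smul_eq_mul]
              have : a 0 x + t * a 0 x * a 0 x₀ = a 0 x * (1 + t * a 0 x₀) := by ring
              rw [this, hta]
              simp
            · have := hx i
              simp only [LinearMap.add_apply, LinearMap.smul_apply, smul_eq_mul] at this
              simp only [map_add, map_smul, smul_eq_mul]
              linarith
          simp only [map_add, map_smul, smul_eq_mul] at key
          simp only [LinearMap.add_apply, LinearMap.smul_apply, smul_eq_mul]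
          linarith
      refine ⟨Fin.cons (∑ i, l i * (t * a i.succ x₀) - t * c x₀) l, fun i => ?_, ?_⟩
      · refine Fin.cases ?_ hl i
        have h1 : 0 ≤ ∑ i, l i * (t * a i.succ x₀) :=
          Finset.sum_nonneg fun i _ => mul_nonneg (hl i) (mul_nonneg ht0.le (hx₀ i))
        have h2 : t * c x₀ ≤ 0 := mul_nonpos_of_nonneg_of_nonpos ht0.le hcx₀.le
        simp only [Fin.cons_zero]
        linarith
      · ext x
        have hx := LinearMap.congr_fun hc x
        simp only [LinearMap.add_apply, LinearMap.smul_apply, smul_eq_mul, LinearMap.sum_apply,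
          mul_add, Finset.sum_add_distrib] at hx
        simp only [Fin.sum_univ_succ, Fin.cons_zero, Fin.cons_succ, LinearMap.add_apply,
          LinearMap.smul_apply, smul_eq_mul, LinearMap.sum_apply, sub_mul, Finset.sum_mul]
        have : ∑ i, l i * (t * a i.succ x₀) * a 0 x = ∑ i, l i * (t * a i.succ x₀ * a 0 x) :=
          Finset.sum_congr rfl fun _ _ => by ring
        linarith

/-- The slack of an objective function in an LP formulation is a nonnegative combination of the
slacks of the inequalities and a constant. -/
lemma LPFormulation.exists_dual {P : MaximizationProblem} {g : P.Obj → ℝ}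
    (L : LPFormulation P g) (s₀ : P.Sol) (o : P.Obj) :
    ∃ l : Fin (L.size + 1) → ℝ, (∀ i, 0 ≤ l i) ∧ ∀ s, g o - P.value o s =
      ∑ i, l i * (Fin.cons 1 (fun i => L.b i - L.A.mulVec (L.x s) i) : Fin (L.size + 1) → ℝ) i := by
  set E := (Fin L.dim → ℝ) × ℝ
  let fst : E →ₗ[ℝ] (Fin L.dim → ℝ) := LinearMap.fst ℝ _ _
  let snd : E →ₗ[ℝ] ℝ := LinearMap.snd ℝ _ _
  let ineq : Fin L.size → E →ₗ[ℝ] ℝ :=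
    fun i => L.b i • snd - (LinearMap.proj i ∘ₗ L.A.mulVecLin) ∘ₗ fst
  let obj : E →ₗ[ℝ] ℝ := (g o - L.w o 0) • snd - (L.w o).linear ∘ₗ fst
  have hw : ∀ y, L.w o y = (L.w o).linear y + L.w o 0 := fun y => by
    have := congrFun (L.w o).decomp y
    simpa using this
  have hobj : ∀ y t, obj (y, t) = (g o - L.w o 0) * t - (L.w o).linear y := fun y t => rfl
  have hineq : ∀ i y t, ineq i (y, t) = L.b i * t - L.A.mulVec y i := fun i y t => rfl
  have hx₀ := L.feasible s₀
  obtain ⟨l, hl, hsum⟩ := exists_nonneg_combination (L.size + 1) (Fin.cons snd ineq) obj (by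
    rintro ⟨y, t⟩ hyt
    have ht : 0 ≤ t := hyt 0
    have hy : ∀ i, 0 ≤ L.b i * t - L.A.mulVec y i := fun i => by
      have := hyt i.succ
      rwa [Fin.cons_succ, hineq] at this
    rw [hobj]
    rcases ht.eq_or_lt with rfl | ht
    · by_contra hneg
      have hpos : 0 < (L.w o).linear y := by simpa using hneg
      obtain ⟨r, hr⟩ := exists_nat_gt ((g o - L.w o (L.x s₀)) / (L.w o).linear y)
      rw [div_lt_iff₀ hpos] at hr
      have h1 := L.w_le o (L.x s₀ + (r : ℝ) • y) fun i => by
        rw [Matrix.mulVec_add, Matrix.mulVec_smul]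
        have h2 := hx₀ i
        have h3 := hy i
        have h4 : (0 : ℝ) ≤ r := Nat.cast_nonneg r
        simp only [Pi.add_apply, Pi.smul_apply, smul_eq_mul]
        nlinarith
      rw [hw, map_add, map_smul, smul_eq_mul] at h1
      rw [hw] at hr
      linarith
    · have h1 := L.w_le o (t⁻¹ • y) fun i => by
        rw [Matrix.mulVec_smul, Pi.smul_apply, smul_eq_mul, inv_mul_le_iff₀ ht]
        linarith [hy i]
      rw [hw, map_smul, smul_eq_mul] at h1
      have h2 : t * (t⁻¹ * (L.w o).linear y + L.w o 0) ≤ t * g o :=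
        mul_le_mul_of_nonneg_left h1 ht.le
      rw [mul_add, mul_inv_cancel_left₀ ht.ne'] at h2
      linarith)
  refine ⟨l, hl, fun s => ?_⟩
  have h := LinearMap.congr_fun hsum (L.x s, 1)
  rw [hobj, LinearMap.sum_apply] at h
  have hval : g o - P.value o s = (g o - L.w o 0) * 1 - (L.w o).linear (L.x s) := by
    rw [← L.w_eq, hw]; ring
  rw [hval, h]
  refine Finset.sum_congr rfl fun i _ => ?_
  refine Fin.cases ?_ (fun i => ?_) i
  · rfl
  · simp [hineq]

/-- An LP formulation gives a factorization of the slacks into nonnegative factors. -/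
lemma LPFormulation.exists_factorization {P : MaximizationProblem} {g : P.Obj → ℝ}
    (L : LPFormulation P g) (s₀ : P.Sol) :
    ∃ (F : Fin (L.size + 1) → P.Obj → ℝ) (G : Fin (L.size + 1) → P.Sol → ℝ),
      (∀ j o, 0 ≤ F j o) ∧ (∀ j s, 0 ≤ G j s) ∧
      ∀ o s, g o - P.value o s = ∑ j, F j o * G j s := by
  choose l hl hsum using L.exists_dual s₀
  refine ⟨fun j o => l o j,
    fun j s => (Fin.cons 1 (fun i => L.b i - L.A.mulVec (L.x s) i) : Fin (L.size + 1) → ℝ) j,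
    fun j o => hl o j, fun j s => ?_, hsum⟩
  refine Fin.cases zero_le_one (fun i => ?_) j
  simpa using L.feasible s i

lemma exists_normalization {α β : Type*} [Fintype α] [Nonempty α] [Fintype β] [Nonempty β]
    {f : α → ℝ} {g : β → ℝ} {B : ℝ} (hf : ∀ a, 0 ≤ f a) (hg : ∀ b, 0 ≤ g b)
    (hfg : ∀ a b, f a * g b ≤ B) :
    ∃ (w : ℝ) (f' : α → ℝ) (g' : β → ℝ), 0 ≤ w ∧ w ≤ B ∧ (∀ a, 0 ≤ f' a) ∧ (∀ a, f' a ≤ 1) ∧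
      (∀ b, 0 ≤ g' b) ∧ (∀ b, g' b ≤ 1) ∧ ∀ a b, f a * g b = w * (f' a * g' b) := by
  obtain ⟨a₀, ha₀⟩ := Finite.exists_max f
  obtain ⟨b₀, hb₀⟩ := Finite.exists_max g
  have hfa : ∀ a, f a = f a₀ * (f a / f a₀) := fun a => by
    rcases (hf a₀).eq_or_lt with h | h
    · have : f a = 0 := le_antisymm (h ▸ ha₀ a) (hf a)
      simp [this]
    · field_simp
  have hgb : ∀ b, g b = g b₀ * (g b / g b₀) := fun b => by
    rcases (hg b₀).eq_or_lt with h | h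
    · have : g b = 0 := le_antisymm (h ▸ hb₀ b) (hg b)
      simp [this]
    · field_simp
  refine ⟨f a₀ * g b₀, fun a => f a / f a₀, fun b => g b / g b₀, mul_nonneg (hf _) (hg _),
    hfg _ _, fun a => div_nonneg (hf _) (hf _), fun a => div_le_one_of_le₀ (ha₀ a) (hf _),
    fun b => div_nonneg (hg _) (hg _), fun b => div_le_one_of_le₀ (hb₀ b) (hg _), fun a b => ?_⟩
  conv_lhs => rw [hfa a, hgb b]
  ring

/-- The subgraph of the complete graph that joins each vertex with its image under a
fixed-point-free involution. -/
def partnerSubgraph {n : ℕ} (p : Fin n → Fin n) (hp : Function.Involutive p)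
    (hne : ∀ v, p v ≠ v) : (completeG n).Subgraph where
  verts := Set.univ
  Adj u v := p u = v
  adj_sub := fun {u v} h => by
    rw [SimpleGraph.top_adj]
    rintro rfl
    exact hne u h
  edge_vert := fun _ => Set.mem_univ _
  symm := ⟨fun u v h => by rw [← h, hp u]⟩

lemma partnerSubgraph_isPerfectMatching {n : ℕ} (p : Fin n → Fin n)
    (hp : Function.Involutive p) (hne : ∀ v, p v ≠ v) :
    (partnerSubgraph p hp hne).IsPerfectMatching := by
  rw [SimpleGraph.Subgraph.isPerfectMatching_iff]
  exact fun v => ⟨p v, rfl, fun w hw => Eq.symm hw⟩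

lemma two_mul_value_partnerSubgraph {n : ℕ} (p : Fin n → Fin n) (hp : Function.Involutive p)
    (hne : ∀ v, p v ≠ v) (U : Finset (Fin n)) :
    2 * ((partnerSubgraph p hp hne).edgeSet ∩ (completeOn U).edgeSet).ncard =
      (U.filter fun v => p v ∈ U).card := by
  classical
  let H : SimpleGraph (Fin n) := ((partnerSubgraph p hp hne) ⊓ completeOn U).spanningCoe
  have hE : (partnerSubgraph p hp hne).edgeSet ∩ (completeOn U).edgeSet =
      (H.edgeFinset : Set (Sym2 (Fin n))) := by
    simp [H, SimpleGraph.Subgraph.edgeSet_inf]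
  have hadj : ∀ u v, H.Adj u v ↔ p u = v ∧ u ∈ U ∧ v ∈ U := by
    intro u v
    have h1 : H.Adj u v ↔ (partnerSubgraph p hp hne).Adj u v ∧ (completeOn U).Adj u v := by
      simp [H]
    have h2 : (partnerSubgraph p hp hne).Adj u v ↔ p u = v := Iff.rfl
    have h3 : (completeOn U).Adj u v ↔ u ∈ U ∧ v ∈ U ∧ u ≠ v := by
      simp [completeOn]
    rw [h1, h2, h3]
    constructor
    · rintro ⟨h, hu, hv, -⟩
      exact ⟨h, hu, hv⟩
    · rintro ⟨rfl, hu, hv⟩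
      exact ⟨rfl, hu, hv, (hne u).symm⟩
  have hdeg : ∀ v, H.degree v = if v ∈ U ∧ p v ∈ U then 1 else 0 := by
    intro v
    rw [← SimpleGraph.card_neighborFinset_eq_degree]
    split_ifs with h
    · rw [Finset.card_eq_one]
      refine ⟨p v, ?_⟩
      ext w
      rw [SimpleGraph.mem_neighborFinset, hadj, Finset.mem_singleton]
      exact ⟨fun hw => hw.1.symm, fun hw => ⟨hw.symm, h.1, hw ▸ h.2⟩⟩
    · rw [Finset.card_eq_zero, Finset.eq_empty_iff_forall_notMem]
      intro w hw
      rw [SimpleGraph.mem_neighborFinset, hadj] at hw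
      exact h ⟨hw.2.1, hw.1 ▸ hw.2.2⟩
  rw [hE, Set.ncard_coe_finset, ← SimpleGraph.sum_degrees_eq_twice_card_edges,
    Finset.sum_congr rfl fun v _ => hdeg v, Finset.sum_boole, Nat.cast_id]
  congr 1
  ext v
  simp

section Doubling

variable {X : Type*} [DecidableEq X]

/-- The partner of an element in two copies of `X`: the other copy for a fixed point of `σ`, and
the image under `σ` in the same copy otherwise. -/
def doublePartner (σ : X → X) (y : X × Bool) : X × Bool :=
  if σ y.1 = y.1 then (y.1, !y.2) else (σ y.1, y.2)

lemma doublePartner_involutive {σ : X → X} (hσ : Function.Involutive σ) :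
    Function.Involutive (doublePartner σ) := by
  rintro ⟨x, b⟩
  by_cases h : σ x = x
  · simp [doublePartner, h]
  · have h' : ¬ x = σ x := fun h' => h h'.symm
    simp [doublePartner, h, hσ x, h']

lemma doublePartner_ne (σ : X → X) (y : X × Bool) : doublePartner σ y ≠ y := by
  obtain ⟨x, b⟩ := y
  by_cases h : σ x = x
  · simp [doublePartner, h]
  · simp [doublePartner, h]

variable {n : ℕ} (e : X × Bool ≃ Fin n)

lemma doublePartner_conj_involutive {σ : X → X} (hσ : Function.Involutive σ) :
    Function.Involutive (e ∘ doublePartner σ ∘ e.symm) :=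
  fun v => by simp [doublePartner_involutive hσ (e.symm v)]

lemma doublePartner_conj_ne (σ : X → X) (v : Fin n) : (e ∘ doublePartner σ ∘ e.symm) v ≠ v := by
  rw [Function.comp_apply, Function.comp_apply, ne_eq, ← Equiv.eq_symm_apply]
  exact doublePartner_ne σ _

/-- The perfect matching given by an involution on half of the vertices. -/
def doubleMatching (σ : X → X) (hσ : Function.Involutive σ) : (completeG n).Subgraph :=
  partnerSubgraph (e ∘ doublePartner σ ∘ e.symm) (doublePartner_conj_involutive e hσ)
    (doublePartner_conj_ne e σ)

lemma doubleMatching_isPerfectMatching (σ : X → X) (hσ : Function.Involutive σ) :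
    (doubleMatching e σ hσ).IsPerfectMatching := partnerSubgraph_isPerfectMatching _ _ _

/-- The vertices of the first half that belong to `U`. -/
def halfSet (U : X → Bool) : Finset (Fin n) :=
  Finset.univ.filter fun v => (e.symm v).2 = false ∧ U (e.symm v).1 = true

omit [DecidableEq X] in
lemma card_halfSet_filter [Fintype X] (U : X → Bool) (p : X → Prop) [DecidablePred p] :
    ((halfSet e U).filter fun v => p (e.symm v).1).card =
      (Finset.univ.filter fun x => U x = true ∧ p x).card := by
  have hinj : Function.Injective fun x : X => e (x, false) := fun x y h => by simpa using h
  rw [← Finset.card_map ⟨_, hinj⟩]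
  congr 1
  ext v
  obtain ⟨⟨x, b⟩, rfl⟩ := e.surjective v
  cases b <;> simp [halfSet]

lemma card_halfSet_eq [Fintype X] {U : X → Bool} {σ : X → X} (hσ : Function.Involutive σ)
    (hU : ∀ x, U (σ x) = U x) :
    (halfSet e U).card = fixedCount U σ +
      2 * ((doubleMatching e σ hσ).edgeSet ∩ (completeOn (halfSet e U)).edgeSet).ncard := by
  rw [doubleMatching, two_mul_value_partnerSubgraph, fixedCount,
    ← card_halfSet_filter e U fun x => σ x = x,
    ← Finset.card_filter_add_card_filter_not (s := halfSet e U) fun v => σ (e.symm v).1 = (e.symm v).1]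
  congr 2
  ext v
  simp only [Finset.mem_filter, and_congr_right_iff]
  intro hv
  obtain ⟨⟨x, b⟩, rfl⟩ := e.surjective v
  simp only [halfSet, Finset.mem_filter, Finset.mem_univ, true_and, Equiv.symm_apply_apply,
    Function.comp_apply, doublePartner] at hv ⊢
  obtain ⟨rfl, hUx⟩ := hv
  by_cases h : σ x = x
  · simp [h]
  · simp [h, hU, hUx]

end Doubling

/-- The slack of the restricted matching problem at the objective function and the solution given
by a compatible pair of a set and an involution. -/
lemma slack_halfSet {X : Type*} [DecidableEq X] [Fintype X] {n : ℕ} (e : X × Bool ≃ Fin n) (ε : ℝ)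
    {U : X → Bool} {σ : X → X} (hσ : Function.Involutive σ) (hU : ∀ x, U (σ x) = U x) :
    ((halfSet e U).card - 1 + ε) / 2 -
      (((doubleMatching e σ hσ).edgeSet ∩ (completeOn (halfSet e U)).edgeSet).ncard : ℝ) =
      ((fixedCount U σ : ℝ) - 1 + ε) / 2 := by
  have h : ((halfSet e U).card : ℝ) = fixedCount U σ +
      2 * ((doubleMatching e σ hσ).edgeSet ∩ (completeOn (halfSet e U)).edgeSet).ncard := by
    exact_mod_cast card_halfSet_eq e hσ hU
  rw [h]
  ring

/-- An LP formulation of the restricted matching problem gives a factorization of the slacks. -/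
lemma exists_restricted_factorization {n : ℕ} {ε : ℝ} {hε : 0 < ε}
    (L : LPFormulation (restrictedMatchingProblem n ε hε).toMaximizationProblem
        (restrictedMatchingProblem n ε hε).guarantee)
    (M₀ : {M : (completeG n).Subgraph // M.IsPerfectMatching}) :
    ∃ (F : Fin (L.size + 1) → {U : Finset (Fin n) // Odd U.card} → ℝ)
      (G : Fin (L.size + 1) → {M : (completeG n).Subgraph // M.IsPerfectMatching} → ℝ),
      (∀ j o, 0 ≤ F j o) ∧ (∀ j s, 0 ≤ G j s) ∧
      ∀ o s, (o.1.card - 1 + ε) / 2 - ((s.1.edgeSet ∩ (completeOn o.1).edgeSet).ncard : ℝ) =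
        ∑ j, F j o * G j s :=
  L.exists_factorization M₀

/-- LP formulations of the restricted matching problem have exponentially many inequalities. -/
theorem exists_size_bound {ε : ℝ} (hε : 0 < ε) (hε1 : ε < 1) :
    ∃ (m : ℕ) (δ c : ℝ), 0 < m ∧ 0 < δ ∧ 0 < c ∧ ∀ (N l n : ℕ) [NeZero N],
      n = 2 * (3 + N * (m * 2) + l) →
      ∀ L : LPFormulation (restrictedMatchingProblem n ε hε).toMaximizationProblem
        (restrictedMatchingProblem n ε hε).guarantee,
        c * Real.exp (δ * N) ≤ (L.size + 1) * n := by
  classical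
  obtain ⟨m, δ, c, hm, hδ, hc, hrank⟩ := exists_rank_bound hε hε1
  refine ⟨m, δ, c, hm, hδ, hc, fun N l n _ hn L => ?_⟩
  have hcard : Fintype.card ((Ground N m ⊕ Fin l) × Bool) = Fintype.card (Fin n) := by
    simp only [Fintype.card_prod, Fintype.card_sum, Fintype.card_fin, Fintype.card_bool, hn]
    ring
  have e := Fintype.equivOfCardEq hcard
  have hinv : ∀ σ : Ground N m → Ground N m, Function.Involutive σ →
      Function.Involutive (Sum.map σ id : Ground N m ⊕ Fin l → Ground N m ⊕ Fin l) :=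
    fun σ hσ => Sum.rec (fun x => by simp [hσ x]) fun x => rfl
  obtain ⟨F, G, hF, hG, hFG⟩ := exists_restricted_factorization L
    ⟨doubleMatching e id fun _ => rfl, doubleMatching_isPerfectMatching e _ _⟩
  set U' : (Ground N m → Bool) → Ground N m ⊕ Fin l → Bool :=
    fun U => Sum.elim U fun _ => false with hU'
  set f : Fin (L.size + 1) → (Ground N m → Bool) → ℝ := fun j U =>
    if h : Odd (halfSet e (U' U)).card then F j ⟨halfSet e (U' U), h⟩ else 0 with hf
  set g : Fin (L.size + 1) → (Ground N m → Ground N m) → ℝ := fun j σ =>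
    if h : Function.Involutive σ then G j ⟨doubleMatching e (Sum.map σ id) (hinv σ h), doubleMatching_isPerfectMatching e _ _⟩
    else 0
    with hg
  have hf0 : ∀ j U, 0 ≤ f j U := fun j U => by
    simp only [hf]; split_ifs; exacts [hF _ _, le_rfl]
  have hg0 : ∀ j σ, 0 ≤ g j σ := fun j σ => by
    simp only [hg]; split_ifs; exacts [hG _ _, le_rfl]
  have hslack : ∀ (o : {U : Finset (Fin n) // Odd U.card}) s j, F j o * G j s ≤ n := by
    intro o s j
    have h1 : (0 : ℝ) ≤ ((s.1.edgeSet ∩ (completeOn o.1).edgeSet).ncard : ℝ) := Nat.cast_nonneg _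
    have h2 : (o.1.card : ℝ) ≤ n := by
      exact_mod_cast (Finset.card_le_univ o.1).trans (by simp)
    have h3 : (0 : ℝ) ≤ n := Nat.cast_nonneg n
    calc F j o * G j s ≤ ∑ j, F j o * G j s :=
          Finset.single_le_sum (f := fun j => F j o * G j s)
            (fun j _ => mul_nonneg (hF _ _) (hG _ _)) (Finset.mem_univ j)
      _ ≤ n := by rw [← hFG]; linarith
  have hfg : ∀ j U σ, f j U * g j σ ≤ n := by
    intro j U σ
    simp only [hf, hg]
    split_ifs
    · exact hslack _ _ _
    all_goals simp
  choose w f' g' hw0 hwB hf0' hf1' hg0' hg1' hfg' using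
    fun j => exists_normalization (hf0 j) (hg0 j) (hfg j)
  have hfinal := hrank N (Fin (L.size + 1)) w f' g' n hw0 hwB hf0' hf1' hg0' hg1' (by
    intro U σ hσ hU hodd
    have hcount : fixedCount (U' U) (Sum.map σ id) = fixedCount U σ := by
      rw [fixedCount, fixedCount]
      refine Eq.trans ?_ (Finset.card_map (Function.Embedding.inl : _ ↪ _ ⊕ Fin l))
      congr 1
      ext x
      rcases x with x | x <;> simp [hU']
    have hUext : ∀ x, U' U (Sum.map σ id x) = U' U x :=
      Sum.rec (fun x => by simp [hU', hU x]) fun x => rfl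
    have hodd' : Odd (halfSet e (U' U)).card := by
      rw [card_halfSet_eq e (hinv σ hσ) hUext, hcount]
      exact hodd.add_even (even_two_mul _)
    rw [← hcount, ← slack_halfSet e ε (hinv σ hσ) hUext,
      hFG ⟨_, hodd'⟩ ⟨_, doubleMatching_isPerfectMatching e _ (hinv σ hσ)⟩]
    refine Finset.sum_congr rfl fun j _ => ?_
    rw [← hfg' j U σ]
    simp only [hf, hg, dif_pos hodd', dif_pos hσ])
  simpa using hfinal

/-- LP formulations of the restricted matching problem on `n` vertices have size `2^{Ω(n)}`. -/
theorem exists_two_pow_le_size {ε : ℝ} (hε : 0 < ε) (hε1 : ε < 1) :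
    ∃ c : ℝ, 0 < c ∧ ∃ n₀ : ℕ, ∀ n : ℕ, n₀ ≤ n → Even n →
      ∀ L : LPFormulation (restrictedMatchingProblem n ε hε).toMaximizationProblem
        (restrictedMatchingProblem n ε hε).guarantee,
        (2 : ℝ) ^ (c * (n : ℝ)) ≤ L.size := by
  obtain ⟨m, δ, c, hm, hδ, hc, hsize⟩ := exists_size_bound hε hε1
  have hm' : (0 : ℝ) < m := by exact_mod_cast hm
  set a := δ / (16 * m) with ha
  have ha0 : 0 < a := by positivity
  have htend : Filter.Tendsto (fun n : ℕ => Real.exp (a * n) / (a * n) ^ 1)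
      Filter.atTop Filter.atTop :=
    (Real.tendsto_exp_div_pow_atTop 1).comp
      (tendsto_natCast_atTop_atTop.const_mul_atTop ha0)
  obtain ⟨n₁, hn₁⟩ := Filter.eventually_atTop.1 (htend.eventually_ge_atTop (2 / (c * a)))
  refine ⟨a, ha0, max n₁ (16 * m + 12), fun n hn heven L => ?_⟩
  have hn1 : n₁ ≤ n := (le_max_left _ _).trans hn
  have hn2 : 16 * m + 12 ≤ n := (le_max_right _ _).trans hn
  obtain ⟨h, hh⟩ := heven
  set N := (h - 3) / (m * 2) with hN
  have hdiv := Nat.div_add_mod (h - 3) (m * 2)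
  have hmod := Nat.mod_lt (h - 3) (show 0 < m * 2 by omega)
  rw [← hN] at hdiv
  have hNbig : n ≤ 8 * m * N := by
    have h8 : 8 * m * N = 4 * (m * 2 * N) := by ring
    omega
  have hN0 : N ≠ 0 := by
    rintro h0
    rw [h0] at hNbig
    omega
  have : NeZero N := ⟨hN0⟩
  have key := hsize N ((h - 3) % (m * 2)) n (by
    have : N * (m * 2) = m * 2 * N := by ring
    omega) L
  have hexp : Real.exp (a * n) * Real.exp (a * n) ≤ Real.exp (δ * N) := by
    rw [← Real.exp_add, Real.exp_le_exp]
    have h1 : (n : ℝ) ≤ 8 * m * N := by exact_mod_cast hNbig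
    have h2 : a * (16 * m) = δ := by rw [ha]; field_simp
    rw [← h2]
    nlinarith
  have hnpos : (0 : ℝ) < n := by
    have : 0 < n := by omega
    exact_mod_cast this
  have hE := hn₁ n hn1
  rw [pow_one, div_le_div_iff₀ (by positivity) (by positivity)] at hE
  have hE1 : 1 ≤ Real.exp (a * n) := Real.one_le_exp (by positivity)
  have hE2 : 2 * n ≤ c * Real.exp (a * n) := by
    have h1 : 2 * n * a ≤ c * Real.exp (a * n) * a := by linarith
    exact le_of_mul_le_mul_right h1 ha0
  have hbig : 2 * Real.exp (a * n) * n ≤ (L.size + 1) * n := by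
    calc 2 * Real.exp (a * n) * n = (2 * n) * Real.exp (a * n) := by ring
      _ ≤ (c * Real.exp (a * n)) * Real.exp (a * n) :=
          mul_le_mul_of_nonneg_right hE2 (Real.exp_pos _).le
      _ = c * (Real.exp (a * n) * Real.exp (a * n)) := by ring
      _ ≤ c * Real.exp (δ * N) := mul_le_mul_of_nonneg_left hexp hc.le
      _ ≤ _ := key
  have hL : 2 * Real.exp (a * n) ≤ L.size + 1 := le_of_mul_le_mul_right hbig hnpos
  calc (2 : ℝ) ^ (a * n) ≤ Real.exp (a * n) := by
        rw [Real.rpow_def_of_pos (by norm_num), Real.exp_le_exp]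
        have : Real.log 2 ≤ 1 := by linarith [Real.log_two_lt_d9]
        have : 0 < a * n := by positivity
        nlinarith
    _ ≤ L.size := by linarith

/-- An LP formulation whose variables and inequalities are indexed by finite types. -/
lemma exists_lpFormulation_of_fintype {P : MaximizationProblem} {g : P.Obj → ℝ} {ι κ : Type}
    [Fintype ι] [Fintype κ] (A : Matrix κ ι ℝ) (b : κ → ℝ) (x : P.Sol → ι → ℝ)
    (w : P.Obj → ι → ℝ) (hx : ∀ s, A.mulVec (x s) ≤ b) (hw : ∀ o s, w o ⬝ᵥ x s = P.value o s)
    (hle : ∀ o y, A.mulVec y ≤ b → w o ⬝ᵥ y ≤ g o) :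
    ∃ L : LPFormulation P g, L.size = Fintype.card κ := by
  set ei := Fintype.equivFin ι
  set ek := Fintype.equivFin κ
  have hmul : ∀ y : Fin (Fintype.card ι) → ℝ,
      (Matrix.reindex ek ei A).mulVec y = A.mulVec (y ∘ ei) ∘ ek.symm := fun y => by
    rw [Matrix.reindex_apply, Matrix.submatrix_mulVec_equiv]
    rfl
  let lin : P.Obj → (Fin (Fintype.card ι) → ℝ) →ₗ[ℝ] ℝ :=
    fun o => (dotProductBilin ℝ ℝ (w o)) ∘ₗ LinearMap.funLeft ℝ ℝ ei
  have hlin : ∀ o y, lin o y = w o ⬝ᵥ (y ∘ ei) := fun o y => rfl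
  refine ⟨{ dim := Fintype.card ι
            size := Fintype.card κ
            A := Matrix.reindex ek ei A
            b := b ∘ ek.symm
            x := fun s => x s ∘ ei.symm
            w := fun o => (lin o).toAffineMap
            feasible := fun s i => ?_
            w_eq := fun o s => ?_
            w_le := fun o y hy => ?_ }, rfl⟩
  · rw [hmul]
    have : (x s ∘ ei.symm) ∘ ei = x s := by funext; simp
    rw [this]
    exact hx s _
  · have : (x s ∘ ei.symm) ∘ ei = x s := by funext; simp
    rw [LinearMap.coe_toAffineMap, hlin, this, hw]
  · rw [LinearMap.coe_toAffineMap, hlin]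
    refine hle o _ fun i => ?_
    have := hy (ek i)
    rw [hmul] at this
    simpa using this

section Flow

variable {n : ℕ}

/-- The number of edges of `M` in `G`. -/
noncomputable def commonEdges (M G : (completeG n).Subgraph) : ℝ :=
  ((M.edgeSet ∩ G.edgeSet).ncard : ℝ)

open Classical in
lemma commonEdges_of_edgeSet_eq_insert {M M' G : (completeG n).Subgraph} {e : Sym2 (Fin n)}
    (h : M.edgeSet = insert e M'.edgeSet) (he : e ∉ M'.edgeSet) :
    commonEdges M G = commonEdges M' G + if e ∈ G.edgeSet then 1 else 0 := by
  rw [commonEdges, commonEdges, h]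
  split_ifs with hG
  · rw [Set.insert_inter_of_mem hG, Set.ncard_insert_of_notMem (fun hmem => he hmem.1)
      (Set.toFinite _)]
    push_cast
    ring
  · rw [Set.insert_inter_of_notMem hG, add_zero]

lemma exists_matching_sup {M : (completeG n).Subgraph} (hM : M.IsMatching) {u v : Fin n}
    (huv : u ≠ v) (hu : u ∉ M.verts) (hv : v ∉ M.verts) :
    ∃ M' : (completeG n).Subgraph, M'.IsMatching ∧ M'.verts = M.verts ∪ {u, v} ∧
      M'.edgeSet = insert s(u, v) M.edgeSet ∧ s(u, v) ∉ M.edgeSet := by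
  have hadj : (completeG n).Adj u v := huv
  refine ⟨M ⊔ (completeG n).subgraphOfAdj hadj,
    hM.sup (SimpleGraph.Subgraph.IsMatching.subgraphOfAdj hadj) ?_, rfl, ?_, ?_⟩
  · rw [hM.support_eq_verts, SimpleGraph.support_subgraphOfAdj, Set.disjoint_right]
    rintro x (rfl | rfl)
    exacts [hu, hv]
  · rw [SimpleGraph.Subgraph.edgeSet_sup, SimpleGraph.edgeSet_subgraphOfAdj, Set.union_singleton]
  · exact fun hmem => hu (M.edge_vert (SimpleGraph.Subgraph.mem_edgeSet.1 hmem))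

lemma isMatching_deleteVerts {M : (completeG n).Subgraph} (hM : M.IsMatching) {u v : Fin n}
    (huv : M.Adj u v) :
    (M.deleteVerts {u, v}).IsMatching ∧
      M.edgeSet = insert s(u, v) (M.deleteVerts {u, v}).edgeSet ∧
      s(u, v) ∉ (M.deleteVerts {u, v}).edgeSet := by
  have hout : ∀ x y, M.Adj x y → x ∉ ({u, v} : Set (Fin n)) → y ∉ ({u, v} : Set (Fin n)) := by
    rintro x y hxy hx (rfl | rfl)
    · exact hx (Or.inr (hM.eq_of_adj_right hxy huv.symm))
    · exact hx (Or.inl (hM.eq_of_adj_right hxy huv))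
  refine ⟨?_, ?_, ?_⟩
  · rintro x ⟨hx, hxuv⟩
    obtain ⟨y, hxy, huniq⟩ := hM hx
    refine ⟨y, ?_, fun z hz => huniq z ?_⟩
    · exact SimpleGraph.Subgraph.deleteVerts_adj.2
        ⟨hx, hxuv, M.edge_vert hxy.symm, hout x y hxy hxuv, hxy⟩
    · exact (SimpleGraph.Subgraph.deleteVerts_adj.1 hz).2.2.2.2
  · ext e
    induction e with
    | _ x y =>
      rw [Set.mem_insert_iff, SimpleGraph.Subgraph.mem_edgeSet, SimpleGraph.Subgraph.mem_edgeSet,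
        SimpleGraph.Subgraph.deleteVerts_adj]
      constructor
      · intro hxy
        by_cases hx : x ∈ ({u, v} : Set (Fin n))
        · left
          rcases hx with rfl | rfl
          · rw [hM.eq_of_adj_left hxy huv]
          · rw [hM.eq_of_adj_left hxy huv.symm, Sym2.eq_swap]
        · exact Or.inr ⟨M.edge_vert hxy, hx, M.edge_vert hxy.symm, hout x y hxy hx, hxy⟩
      · rintro (h | h)
        · have : s(x, y) ∈ M.edgeSet := h ▸ SimpleGraph.Subgraph.mem_edgeSet.2 huv
          exact this
        · exact h.2.2.2.2
  · intro h
    have := (SimpleGraph.Subgraph.deleteVerts_adj.1 (SimpleGraph.Subgraph.mem_edgeSet.1 h)).2.1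
    exact this (Or.inl rfl)

/-- The largest number of edges of `G` in a matching with vertices in `S`. -/
noncomputable def matchingPotential (G : (completeG n).Subgraph) (S : Finset (Fin n)) : ℝ :=
  ⨆ M : {M : (completeG n).Subgraph // M.IsMatching ∧ M.verts ⊆ S}, commonEdges M.1 G

lemma commonEdges_le_matchingPotential {M : (completeG n).Subgraph} (hM : M.IsMatching)
    (G : (completeG n).Subgraph) {S : Finset (Fin n)} (hS : M.verts ⊆ S) :
    commonEdges M G ≤ matchingPotential G S :=
  le_ciSup (f := fun M : {M : (completeG n).Subgraph // M.IsMatching ∧ M.verts ⊆ S} =>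
    commonEdges M.1 G) (Set.finite_range _).bddAbove ⟨M, hM, hS⟩

lemma isMatching_bot : (⊥ : (completeG n).Subgraph).IsMatching := fun _ h => h.elim

lemma matchingPotential_nonneg (G : (completeG n).Subgraph) (S : Finset (Fin n)) :
    0 ≤ matchingPotential G S :=
  (Nat.cast_nonneg _).trans
    (commonEdges_le_matchingPotential isMatching_bot G (by simp))

/-- The ways to match two vertices of a set. -/
abbrev MatchingStep (n : ℕ) : Type :=
  {a : Finset (Fin n) × Fin n × Fin n // a.2.1 ∈ a.1 ∧ a.2.2 ∈ a.1 ∧ a.2.1 ≠ a.2.2}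

/-- The set of vertices that remain after a step. -/
def MatchingStep.head (a : MatchingStep n) : Finset (Fin n) := (a.1.1.erase a.1.2.1).erase a.1.2.2

/-- The edge used by a step. -/
def MatchingStep.edge (a : MatchingStep n) : Sym2 (Fin n) := s(a.1.2.1, a.1.2.2)

open Classical in
lemma add_matchingPotential_le (G : (completeG n).Subgraph) (a : MatchingStep n) :
    (if a.edge ∈ G.edgeSet then 1 else 0) + matchingPotential G a.head ≤
      matchingPotential G a.1.1 := by
  have hne : Nonempty {M : (completeG n).Subgraph // M.IsMatching ∧ M.verts ⊆ a.head} :=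
    ⟨⟨⊥, isMatching_bot, by simp⟩⟩
  rw [add_comm, ← le_sub_iff_add_le]
  refine ciSup_le fun M => ?_
  obtain ⟨M, hM, hMS⟩ := M
  obtain ⟨⟨S, u, v⟩, hu, hv, huv⟩ := a
  replace hMS : M.verts ⊆ ((S.erase u).erase v : Finset (Fin n)) := hMS
  obtain ⟨M', hM', hverts, hedges, hnot⟩ := exists_matching_sup hM huv
    (fun h => by simpa using hMS h) (fun h => by simpa using hMS h)
  rw [le_sub_iff_add_le]
  refine (commonEdges_of_edgeSet_eq_insert hedges hnot).symm.trans_le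
    (commonEdges_le_matchingPotential hM' G ?_)
  rw [hverts]
  refine Set.union_subset (hMS.trans ?_) ?_
  · exact_mod_cast (Finset.erase_subset _ _).trans (Finset.erase_subset _ _)
  · rintro x (rfl | rfl)
    exacts [hu, hv]

/-- The excess of the outflow over the inflow at `T`. -/
noncomputable def netFlow (y : MatchingStep n → ℝ) (T : Finset (Fin n)) : ℝ :=
  ∑ a, ((if a.1.1 = T then 1 else 0) - if a.head = T then 1 else 0) * y a

/-- A flow of value at most one from `S` in the graph of matching steps. -/
def IsMatchingFlow (S : Finset (Fin n)) (y : MatchingStep n → ℝ) : Prop :=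
  (∀ a, 0 ≤ y a) ∧ ∀ T, netFlow y T ≤ if T = S then 1 else 0

open Classical in
/-- The coefficients of the objective function of `G` on flows. -/
noncomputable def stepWeight (G : (completeG n).Subgraph) (a : MatchingStep n) : ℝ :=
  if a.edge ∈ G.edgeSet then 1 else 0

lemma stepWeight_dotProduct_le (G : (completeG n).Subgraph) {S : Finset (Fin n)}
    {y : MatchingStep n → ℝ} (hy : IsMatchingFlow S y) :
    stepWeight G ⬝ᵥ y ≤ matchingPotential G S := by
  calc stepWeight G ⬝ᵥ y
      ≤ ∑ a : MatchingStep n, (matchingPotential G a.1.1 - matchingPotential G a.head) * y a := by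
        refine Finset.sum_le_sum fun a _ => mul_le_mul_of_nonneg_right ?_ (hy.1 a)
        have := add_matchingPotential_le G a
        rw [stepWeight]
        linarith
    _ = ∑ T, matchingPotential G T * netFlow y T := by
        simp only [netFlow, Finset.mul_sum]
        rw [Finset.sum_comm]
        refine Finset.sum_congr rfl fun a _ => ?_
        simp only [← mul_assoc, mul_sub, ← Finset.sum_mul, Finset.sum_sub_distrib]
        simp
    _ ≤ ∑ T, matchingPotential G T * if T = S then 1 else 0 :=
        Finset.sum_le_sum fun T _ =>
          mul_le_mul_of_nonneg_left (hy.2 T) (matchingPotential_nonneg G T)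
    _ = matchingPotential G S := by simp

lemma exists_matchingFlow {M : (completeG n).Subgraph} (hM : M.IsMatching) {S : Finset (Fin n)}
    (hS : M.verts ⊆ S) :
    ∃ y, IsMatchingFlow S y ∧ ∀ G, stepWeight G ⬝ᵥ y = commonEdges M G := by
  classical
  induction S using Finset.strongInduction generalizing M with
  | H S ih =>
    by_cases hne : ∃ u v, M.Adj u v
    · obtain ⟨u, v, huv⟩ := hne
      have hu : u ∈ S := hS (M.edge_vert huv)
      have hv : v ∈ S := hS (M.edge_vert huv.symm)
      obtain ⟨hM', hedges, hnot⟩ := isMatching_deleteVerts hM huv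
      let a : MatchingStep n := ⟨(S, u, v), hu, hv, huv.ne⟩
      have hhead : a.head = (S.erase u).erase v := rfl
      obtain ⟨y, hy, hval⟩ := ih a.head
        ((Finset.erase_subset _ _).trans_ssubset (Finset.erase_ssubset hu)) hM' (by
          rintro x ⟨hx, hxuv⟩
          simp only [Set.mem_insert_iff, Set.mem_singleton_iff, not_or] at hxuv
          simp [hhead, hxuv, hS hx])
      refine ⟨y + Pi.single a 1, ⟨fun b => ?_, fun T => ?_⟩, fun G => ?_⟩
      · have h1 : (0 : MatchingStep n → ℝ) ≤ Pi.single a 1 := Pi.single_nonneg.2 zero_le_one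
        exact add_nonneg (hy.1 b) (h1 b)
      · have hnet : netFlow (y + Pi.single a 1) T = netFlow y T +
            ((if S = T then 1 else 0) - if a.head = T then 1 else 0) := by
          simp only [netFlow, Pi.add_apply, mul_add, Finset.sum_add_distrib]
          congr 1
          simp [Pi.single_apply, a]
        have := hy.2 T
        rw [hnet]
        simp only [eq_comm (a := T)] at this ⊢
        linarith
      · rw [dotProduct_add, hval, dotProduct_single, mul_one,
          commonEdges_of_edgeSet_eq_insert hedges hnot]
        rfl
    · have hempty : M.edgeSet = ∅ := by
        ext e
        induction e with
        | _ x y => simpa using fun h => hne ⟨x, y, h⟩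
      refine ⟨0, ⟨fun _ => le_rfl, fun T => ?_⟩, fun G => ?_⟩
      · simp only [netFlow, Pi.zero_apply, mul_zero, Finset.sum_const_zero]
        split_ifs <;> norm_num
      · simp [commonEdges, hempty]

lemma matchingPotential_univ (G : (completeG n).Subgraph) :
    matchingPotential G Finset.univ ≤ (matchingProblem n).maxValue G := by
  have hne : Nonempty {M : (completeG n).Subgraph // M.IsMatching ∧
      M.verts ⊆ (Finset.univ : Finset (Fin n))} := ⟨⟨⊥, isMatching_bot, by simp⟩⟩
  have hfin : Finite (matchingProblem n).Sol :=
    inferInstanceAs (Finite {M : (completeG n).Subgraph // M.IsMatching})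
  exact ciSup_le fun M => le_ciSup (f := fun s => (matchingProblem n).value G s)
    (Set.finite_range _).bddAbove ⟨M.1, M.2.1⟩

lemma card_matchingStep_add_le : Fintype.card (Finset (Fin n) ⊕ MatchingStep n) ≤ 2 ^ (3 * n) := by
  have h1 : Fintype.card (MatchingStep n) ≤ 2 ^ n * (n * n) :=
    (Fintype.card_subtype_le _).trans (by simp)
  have h2 : n + 1 ≤ 2 ^ n := Nat.lt_two_pow_self
  have h3 : 1 + n * n ≤ 2 ^ n * 2 ^ n := by nlinarith
  calc Fintype.card (Finset (Fin n) ⊕ MatchingStep n) ≤ 2 ^ n + 2 ^ n * (n * n) := by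
        rw [Fintype.card_sum]; simpa using h1
    _ = 2 ^ n * (1 + n * n) := by ring
    _ ≤ 2 ^ n * (2 ^ n * 2 ^ n) := Nat.mul_le_mul_left _ h3
    _ = 2 ^ (3 * n) := by ring

/-- The matching problem has an exact LP formulation of size `2^{O(n)}`. -/
theorem exists_lpFormulation_matchingProblem (n : ℕ) :
    ∃ L : LPFormulation (matchingProblem n) (matchingProblem n).maxValue,
      L.size ≤ 2 ^ (3 * n) := by
  classical
  choose x hx hval using fun M : (matchingProblem n).Sol =>
    exists_matchingFlow M.2 (S := Finset.univ) (by simp)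
  let A : Matrix (Finset (Fin n) ⊕ MatchingStep n) (MatchingStep n) ℝ :=
    Matrix.of (Sum.elim
      (fun T a => (if a.1.1 = T then 1 else 0) - if a.head = T then 1 else 0)
      (fun b a => if a = b then -1 else 0))
  let b : Finset (Fin n) ⊕ MatchingStep n → ℝ :=
    Sum.elim (fun T => if T = Finset.univ then 1 else 0) fun _ => 0
  have hA1 : ∀ y T, A.mulVec y (Sum.inl T) = netFlow y T := fun y T => rfl
  have hA2 : ∀ y a, A.mulVec y (Sum.inr a) = -y a := fun y a => by
    simp [A, Matrix.mulVec, dotProduct]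
  have hiff : ∀ y, A.mulVec y ≤ b ↔ IsMatchingFlow Finset.univ y := by
    intro y
    constructor
    · intro h
      refine ⟨fun a => ?_, fun T => ?_⟩
      · have := h (Sum.inr a)
        rw [hA2] at this
        simpa [b] using this
      · have := h (Sum.inl T)
        rwa [hA1] at this
    · rintro ⟨h1, h2⟩ (T | a)
      · rw [hA1]; exact h2 T
      · rw [hA2]; simpa [b] using h1 a
  obtain ⟨L, hL⟩ := exists_lpFormulation_of_fintype (P := matchingProblem n)
    (g := (matchingProblem n).maxValue) A b x stepWeight (fun s => (hiff _).2 (hx s))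
    (fun o s => hval s o)
    (fun o y hy => (stepWeight_dotProduct_le o ((hiff y).1 hy)).trans (matchingPotential_univ o))
  exact ⟨L, hL ▸ card_matchingStep_add_le⟩

end Flow

/-- An LP formulation remains one when the guarantees are relaxed. -/
def LPFormulation.mono {P : MaximizationProblem} {g g' : P.Obj → ℝ} (L : LPFormulation P g)
    (h : ∀ o, g o ≤ g' o) : LPFormulation P g' :=
  { L with w_le := fun o y hy => (L.w_le o y hy).trans (h o) }

/-- An LP formulation of the matching problem restricts to perfect matchings and complete graphs
on sets of odd size. -/
def LPFormulation.restrict {n : ℕ} {ε : ℝ} (hε : 0 < ε) {g : (matchingProblem n).Obj → ℝ}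
    (L : LPFormulation (matchingProblem n) g)
    (h : ∀ U : Finset (Fin n), Odd U.card → g (completeOn U) ≤ ((U.card : ℝ) - 1 + ε) / 2) :
    LPFormulation (restrictedMatchingProblem n ε hε).toMaximizationProblem
      (restrictedMatchingProblem n ε hε).guarantee where
  dim := L.dim
  size := L.size
  A := L.A
  b := L.b
  x M := L.x ⟨M.1, M.2.1⟩
  w U := L.w (completeOn U.1)
  feasible _ := L.feasible _
  w_eq _ _ := L.w_eq _ _
  w_le U y hy := (L.w_le _ y hy).trans (h U.1 U.2)

lemma maxValue_completeOn_le {n : ℕ} {U : Finset (Fin n)} (hU : Odd U.card) :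
    (matchingProblem n).maxValue (completeOn U) ≤ ((U.card : ℝ) - 1) / 2 := by
  have hne : Nonempty (matchingProblem n).Sol := ⟨⟨⊥, isMatching_bot⟩⟩
  exact ciSup_le fun M => matching_value_completeOn_le U hU M.1 M.2

lemma maxValue_matchingProblem_nonneg {n : ℕ} (G : (completeG n).Subgraph) :
    0 ≤ (matchingProblem n).maxValue G :=
  Real.iSup_nonneg fun _ => Nat.cast_nonneg _

lemma one_sub_div_pos {ε : ℝ} (hε1 : ε < 1) {n : ℕ} (hn : 0 < n) : 0 < 1 - ε / (n : ℝ) := by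
  have h1 : (1 : ℝ) ≤ n := by exact_mod_cast hn
  rw [sub_pos, div_lt_one (by linarith)]
  linarith

lemma factorGuarantee_completeOn_le {ε : ℝ} (hε : 0 < ε) (hε1 : ε < 1) {n : ℕ} (hn : 0 < n)
    {U : Finset (Fin n)} (hU : Odd U.card) :
    (matchingProblem n).factorGuarantee (1 - ε / (n : ℝ)) (completeOn U) ≤
      ((U.card : ℝ) - 1 + ε) / 2 := by
  have hn0 : (0 : ℝ) < n := by exact_mod_cast hn
  have hUn : (U.card : ℝ) ≤ n := by exact_mod_cast (Finset.card_le_univ U).trans_eq (by simp)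
  refine (div_le_iff₀ (one_sub_div_pos hε1 hn)).2 ((maxValue_completeOn_le hU).trans ?_)
  have h1 : ε / (n : ℝ) * ((U.card : ℝ) - 1 + ε) ≤ ε := by
    rw [div_mul_eq_mul_div, div_le_iff₀ hn0]
    exact mul_le_mul_of_nonneg_left (by linarith) hε.le
  linarith

lemma exists_two_pow_le_size_factor {ε : ℝ} (hε : 0 < ε) (hε1 : ε < 1) :
    ∃ c : ℝ, 0 < c ∧ ∃ n₀ : ℕ, ∀ n : ℕ, n₀ ≤ n → Even n →
      ∀ L : LPFormulation (matchingProblem n)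
        ((matchingProblem n).factorGuarantee (1 - ε / (n : ℝ))),
        (2 : ℝ) ^ (c * (n : ℝ)) ≤ L.size := by
  obtain ⟨c, hc, n₀, h⟩ := exists_two_pow_le_size hε hε1
  exact ⟨c, hc, max n₀ 1, fun n hn heven L => h n (le_of_max_le_left hn) heven
    (L.restrict hε fun U => factorGuarantee_completeOn_le hε hε1 (le_of_max_le_right hn))⟩

lemma exists_minLPSize_eq {P : MaximizationProblem} {g : P.Obj → ℝ} (L : LPFormulation P g) :
    ∃ L' : LPFormulation P g, minLPSize P g = (L'.size : ℕ∞) ∧ L'.size ≤ L.size := by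
  have hne : Nonempty (LPFormulation P g) := ⟨L⟩
  obtain ⟨L', hL'⟩ := ciInf_mem fun L : LPFormulation P g => (L.size : ℕ∞)
  refine ⟨L', hL'.symm, ?_⟩
  have : (L'.size : ℕ∞) ≤ L.size := hL'.trans_le (iInf_le _ L)
  exact_mod_cast this

lemma isTwoPowThetaEven_minLPSize {P : ℕ → MaximizationProblem} {g : ∀ n, (P n).Obj → ℝ}
    (hlower : ∃ c : ℝ, 0 < c ∧ ∃ n₀ : ℕ, ∀ n : ℕ, n₀ ≤ n → Even n →
      ∀ L : LPFormulation (P n) (g n), (2 : ℝ) ^ (c * (n : ℝ)) ≤ L.size)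
    (hupper : ∀ n, 0 < n → ∃ L : LPFormulation (P n) (g n), L.size ≤ 2 ^ (3 * n)) :
    IsTwoPowThetaEven fun n => minLPSize (P n) (g n) := by
  obtain ⟨c, hc, n₀, h⟩ := hlower
  refine ⟨c, 3, hc, by norm_num, max n₀ 1, fun n hn heven => ?_⟩
  obtain ⟨L, hL⟩ := hupper n (le_of_max_le_right hn)
  obtain ⟨L', heq, hle⟩ := exists_minLPSize_eq L
  refine ⟨L'.size, heq, h n (le_of_max_le_left hn) heven L', ?_⟩
  have h1 : (L'.size : ℝ) ≤ ((2 ^ (3 * n) : ℕ) : ℝ) := by exact_mod_cast hle.trans hL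
  refine h1.trans_eq ?_
  rw [Nat.cast_pow, ← Real.rpow_natCast]
  push_cast
  rfl

/-- A polynomial in `n` is eventually smaller than `2 ^ (c * n)`. -/
lemma exists_eval_lt_two_rpow (p : MvPolynomial (Fin 2) ℝ) {c : ℝ} (hc : 0 < c) :
    ∃ n₁ : ℕ, ∀ n : ℕ, n₁ ≤ n →
      MvPolynomial.eval ![(n : ℝ), 2 * n] p < (2 : ℝ) ^ (c * (n : ℝ)) := by
  have hlog : 0 < Real.log 2 := Real.log_pos one_lt_two
  set b := c * Real.log 2 with hb
  have hb0 : 0 < b := mul_pos hc hlog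
  let q : Polynomial ℝ := MvPolynomial.aeval
    ![Polynomial.C b⁻¹ * Polynomial.X, Polynomial.C (2 * b⁻¹) * Polynomial.X] p
  have hq : ∀ x : ℝ, q.eval (b * x) = MvPolynomial.eval ![x, 2 * x] p := by
    intro x
    have h1 : (Polynomial.evalRingHom (b * x)).comp
        (MvPolynomial.aeval ![Polynomial.C b⁻¹ * Polynomial.X,
          Polynomial.C (2 * b⁻¹) * Polynomial.X] :
            MvPolynomial (Fin 2) ℝ →ₐ[ℝ] Polynomial ℝ).toRingHom =
        MvPolynomial.eval ![x, 2 * x] := by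
      refine MvPolynomial.ringHom_ext (fun r => by simp) fun i => ?_
      fin_cases i <;> simp <;> field_simp
    exact DFunLike.congr_fun h1 p
  have ht : Filter.Tendsto (fun n : ℕ => q.eval (b * n) / Real.exp (b * n)) Filter.atTop
      (nhds 0) :=
    (Polynomial.tendsto_div_exp_atTop q).comp
      (tendsto_natCast_atTop_atTop.const_mul_atTop hb0)
  obtain ⟨n₁, h⟩ := Filter.eventually_atTop.1 (ht.eventually_lt_const zero_lt_one)
  refine ⟨n₁, fun n hn => ?_⟩
  have h1 := h n hn
  rw [div_lt_one (Real.exp_pos _), hq] at h1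
  rwa [Real.rpow_def_of_pos two_pos, show Real.log 2 * (c * n) = b * n by rw [hb]; ring]

lemma not_admitsFPSRS_matchingProblem : ¬ AdmitsFPSRS matchingProblem := by
  rintro ⟨p, hp⟩
  obtain ⟨c, hc, n₀, h⟩ := exists_two_pow_le_size_factor (ε := 1 / 2) (by norm_num) (by norm_num)
  obtain ⟨n₁, h₁⟩ := exists_eval_lt_two_rpow p hc
  set n := 2 * (max n₀ n₁ + 1) with hn
  have hn₀ : n₀ ≤ n := by have := le_max_left n₀ n₁; omega
  have hn₁ : n₁ ≤ n := by have := le_max_right n₀ n₁; omega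
  have hn1 : (1 : ℝ) ≤ n := by exact_mod_cast (by omega : 1 ≤ n)
  obtain ⟨L, hL⟩ := hp (1 / 2 / n) (by positivity)
    (by rw [div_lt_one (by linarith)]; linarith) n
  have h2 : 1 / (1 / 2 / (n : ℝ)) = 2 * n := by field_simp
  rw [h2] at hL
  exact absurd ((h n hn₀ (hn ▸ even_two_mul _) L).trans hL) (not_le.2 (h₁ n hn₁))

theorem mainTheorem1 :
    (∀ (ε : ℝ) (hε : 0 < ε), ε < 1 →
      IsTwoPowThetaEven (fun n => (restrictedMatchingProblem n ε hε).fc) ∧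
      IsTwoPowThetaEven (fun n => (matchingProblem n).fcFactor (1 - ε / (n : ℝ)))) ∧
    ¬ AdmitsFPSRS matchingProblem := by
  refine ⟨fun ε hε hε1 => ⟨?_, ?_⟩, not_admitsFPSRS_matchingProblem⟩
  · refine isTwoPowThetaEven_minLPSize (exists_two_pow_le_size hε hε1) fun n _ => ?_
    obtain ⟨L, hL⟩ := exists_lpFormulation_matchingProblem n
    exact ⟨L.restrict hε fun U hU => (maxValue_completeOn_le hU).trans (by linarith), hL⟩
  · refine isTwoPowThetaEven_minLPSize (exists_two_pow_le_size_factor hε hε1) fun n hn => ?_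
    obtain ⟨L, hL⟩ := exists_lpFormulation_matchingProblem n
    refine ⟨L.mono fun G => ?_, hL⟩
    exact le_div_self (maxValue_matchingProblem_nonneg G) (one_sub_div_pos hε1 hn)
      (sub_le_self _ (by positivity))
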